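/- Let $r,d,n,D,E$ be natural numbers with $n\ge 3$ and $\log n\le E\le D$, and let $X\subset\mathbb{R}^d$ be a set of at most $n$ unit vectors. Random feature map: let $\omega_{i,j}$ ($1\le i\le D$, $1\le j\le r$) be independent standard Gaussian vectors in $\mathbb{R}^d$, and let $Z:\mathbb{R}^d\to\mathbb{R}^D$ be given by $$Z(x)_i=\frac1{\sqrt D}\prod_{j=1}^r\langle x,\omega_{i,j}\rangle .$$ Johnson–Lindenstrauss projection: let $Q$ be a random $E\times D$ real matrix, independent of $(\omega_{i,j})$, of one of the following two kinds. (i) The entries $Q_{ki}$ are independent, with $\mathbb{E}Q_{ki}=0$, $\mathbb{E}Q_{ki}^2=1/E$ and $\mathbb{E}e^{tQ_{ki}}\le e^{Kt^2/(2E)}$ for all $t\in\mathbb{R}$, where $K\ge0$ is a constant ($K=1$ covers $N(0,1/E)$ entries and uniform $\pm E^{-1/2}$ entries). (ii) $Q$ is a rescaled projection to a uniformly random $E$-dimensional subspace of $\mathbb{R}^D$: almost surely $QQ^{\mathsf T}=\frac DE I_E$, and $QU$ has the same law as $Q$ for every orthogonal $D\times D$ matrix $U$. Put $Z'(x)=Q\,Z(x)\in\mathbb{R}^E$.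 Theorem. For every $a>0$ and $K\ge 0$ there is a constant $C>0$, depending only on $a$ and $K$ (not on $r,d,n,D,E$, on $X$, or on the law of $Q$), such that with probability at least $1-n^{-a}$ the inequality $$\bigl|\langle x,x'\rangle^r-\langle Z'(x),Z'(x')\rangle\bigr|\le C\left(\frac{2^{r+1}(\log n)^{r+1}}{\sqrt D}+\frac{\sqrt{\log n}}{\sqrt E}\right)$$ holds for all $x,x'\in X$ simultaneously. -/

import Mathlib

open MeasureTheory ProbabilityTheory
open scoped RealInnerProductSpace NNReal Matrix

/-- The random feature map `Z : ℝ^d → ℝ^D` for the homogeneous polynomial kernel `⟪x, y⟫ ^ r`, built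
from the vectors `w i j` (`i < D`, `j < r`): its `i`-th coordinate at `x` is
`D^{-1/2} ∏_j ⟪x, w i j⟫`. -/
noncomputable def randomFeatureMap {d r D : ℕ} (w : Fin D → Fin r → EuclideanSpace ℝ (Fin d))
    (x : EuclideanSpace ℝ (Fin d)) : EuclideanSpace ℝ (Fin D) :=
  WithLp.toLp 2 fun i => (√(D : ℝ))⁻¹ * ∏ j, ⟪x, w i j⟫

/-- The compact random feature map `Z' = Q ∘ Z : ℝ^d → ℝ^E`: the random feature map, followed by the
linear map `ℝ^D → ℝ^E` with matrix `Q`. -/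
noncomputable def craftMap {d r D E : ℕ} (w : Fin D → Fin r → EuclideanSpace ℝ (Fin d))
    (Q : Matrix (Fin E) (Fin D) ℝ) (x : EuclideanSpace ℝ (Fin d)) : EuclideanSpace ℝ (Fin E) :=
  Matrix.toEuclideanLin Q (randomFeatureMap w x)

/-- A random `E × D` matrix with independent, centred, sub-Gaussian entries of variance `1 / E`; the
sub-Gaussian variance proxy of the entries is `K / E`. With `K = 1` this includes the matrices with
independent `N(0, 1 / E)` entries and those with independent uniform `± E^{-1/2}` entries. -/
structure IsSubgaussianProjection {Ω : Type*} [MeasurableSpace Ω] {D E : ℕ} (K : ℝ≥0)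
    (Q : Fin E → Fin D → Ω → ℝ) (μ : Measure Ω) : Prop where
  indep : iIndepFun (fun p : Fin E × Fin D => Q p.1 p.2) μ
  mean : ∀ k i, ∫ ω, Q k i ω ∂μ = 0
  second_moment : ∀ k i, ∫ ω, Q k i ω ^ 2 ∂μ = (E : ℝ)⁻¹
  subgaussian : ∀ k i, HasSubgaussianMGF (Q k i) (K / (E : ℝ≥0)) μ

/-- The (rescaled) orthogonal projection of `ℝ^D` to a uniformly random `E`-dimensional subspace,
written in an orthonormal basis of that subspace: `√(E / D) Q` has orthonormal rows, and the law of
`Q` is invariant under all orthogonal transformations of `ℝ^D`. -/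
structure IsOrthogonalProjection {Ω : Type*} [MeasurableSpace Ω] {D E : ℕ}
    (Q : Fin E → Fin D → Ω → ℝ) (μ : Measure Ω) : Prop where
  rows : ∀ᵐ ω ∂μ, (Matrix.of fun k i => Q k i ω) * (Matrix.of fun k i => Q k i ω)ᵀ
    = ((D : ℝ) / E) • (1 : Matrix (Fin E) (Fin E) ℝ)
  invariant : ∀ U ∈ Matrix.orthogonalGroup (Fin D) ℝ,
    IdentDistrib (fun ω (k : Fin E) (i : Fin D) => ((Matrix.of fun k i => Q k i ω) * U) k i)
      (fun ω (k : Fin E) (i : Fin D) => Q k i ω) μ μ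

/-- A Johnson–Lindenstrauss random projection `ℝ^D → ℝ^E`, of either of the two usual kinds. -/
def IsJohnsonLindenstrauss {Ω : Type*} [MeasurableSpace Ω] {D E : ℕ} (K : ℝ≥0)
    (Q : Fin E → Fin D → Ω → ℝ) (μ : Measure Ω) : Prop :=
  IsSubgaussianProjection K Q μ ∨ IsOrthogonalProjection Q μ

/-!
The two sources of randomness are treated one after the other, and their errors are added.

*The random feature map.* For unit vectors `x`, `y` the number `⟪Z x, Z y⟫` is the average of `D`
independent copies of `∏ⱼ ⟪x, ωⱼ⟫ ⟪y, ωⱼ⟫`, whose mean is `⟪x, y⟫ ^ r`. These products have heavy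
tails, so their deviation is controlled through even moments: a Marcinkiewicz–Zygmund inequality
(`integral_sum_pow_le`) reduces the `2m`-th moment of the average to that of one product, which is
at most the `r`-th power of the Gaussian moment `(4m - 1)‼`. In Markov's inequality the moment has
to be chosen so that the constant does not depend on `r` (`exists_moment_bound`): a moment with
`m ≤ log n` wins a factor `exp (-log n / 8)` from each of the `r` factors, which suffices for all
but finitely many `r`.

*The projection.* For a unit vector `u`, the variable `‖Q u‖ ^ 2 - 1` has the exponential moments
of a centred `χ²` variable with `E` degrees of freedom, up to constants
(`IsJohnsonLindenstrauss.lintegral_exp_le`). For sub-Gaussian entries this follows by linearising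
the squares with an auxiliary Gaussian variable; for an orthogonal projection the exponential
moments are compared with those of a Gaussian projection, by rotation invariance and Jensen's
inequality (`lintegral_exp_orthogonal_le`). As `log n ≤ E`, Chernoff's bound gives deviations of
order `√(log n / E)`. By Fubini this applies to the random vectors `Z x ± Z y`, which are independent
of `Q`, and polarization turns it into a bound for inner products, of size `√(log n / E)` times
`(‖Z x‖ ^ 2 + ‖Z y‖ ^ 2) / 2`; the latter is bounded by the first part, applied to `(x, x)` and
`(y, y)`. A union bound over the pairs of points finishes the proof.
-/

/-! ### Even moments of sums of independent centred variables -/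

theorem Nat.choose_two_mul_le (m k : ℕ) : (2 * m).choose (2 * k) ≤ m.choose k * (2 * m) ^ k := by
  induction k with
  | zero => simp
  | succ k ih =>
    have h1 := Nat.choose_succ_right_eq (2 * m) (2 * k + 1)
    have h2 := Nat.choose_succ_right_eq (2 * m) (2 * k)
    have h3 := Nat.choose_succ_right_eq m k
    have h4 : 2 * m - 2 * k = 2 * (m - k) := by omega
    have h5 : 2 * m - (2 * k + 1) ≤ 2 * m := by omega
    rw [h4] at h2
    have : (2 * m).choose (2 * (k + 1)) * ((2 * k + 1) * (2 * k + 2))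
        ≤ m.choose (k + 1) * (2 * m) ^ (k + 1) * ((2 * k + 1) * (2 * k + 2)) := by
      calc (2 * m).choose (2 * (k + 1)) * ((2 * k + 1) * (2 * k + 2))
          = (2 * m).choose (2 * k + 1 + 1) * (2 * k + 1 + 1) * (2 * k + 1) := by ring_nf
        _ = (2 * m).choose (2 * k) * (2 * (m - k)) * (2 * m - (2 * k + 1)) := by
          rw [h1, ← h2]; ring
        _ ≤ (m.choose k * (2 * m) ^ k) * (2 * (m - k)) * (2 * m) := by gcongr
        _ = (m.choose k * (m - k)) * (2 * m) ^ (k + 1) * 2 := by ring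
        _ = m.choose (k + 1) * (2 * m) ^ (k + 1) * (1 * (2 * k + 2)) := by rw [← h3]; ring
        _ ≤ _ := by gcongr; omega
    exact Nat.le_of_mul_le_mul_right this (by positivity)

theorem Finset.sum_range_even_add_odd {M : Type*} [AddCommMonoid M] (f : ℕ → M) (m : ℕ) :
    ∑ j ∈ Finset.range (2 * m + 1), f j
      = ∑ k ∈ Finset.range (m + 1), f (2 * k) + ∑ k ∈ Finset.range m, f (2 * k + 1) := by
  induction m with
  | zero => simp
  | succ m ih =>
    rw [show 2 * (m + 1) + 1 = 2 * m + 1 + 1 + 1 by ring, Finset.sum_range_succ,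
      Finset.sum_range_succ, ih,
      Finset.sum_range_succ _ (m + 1), Finset.sum_range_succ (fun k => f (2 * k + 1)) m,
      show 2 * m + 1 + 1 = 2 * (m + 1) by ring]
    abel

theorem add_pow_two_mul_add_sub_pow_two_mul (a b : ℝ) (m : ℕ) :
    (a + b) ^ (2 * m) + (a - b) ^ (2 * m)
      = 2 * ∑ k ∈ Finset.range (m + 1),
          (b ^ 2) ^ k * (a ^ 2) ^ (m - k) * ((2 * m).choose (2 * k)) := by
  rw [add_comm a b, sub_eq_neg_add, add_pow, add_pow, Finset.sum_range_even_add_odd,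
    Finset.sum_range_even_add_odd]
  have : ∀ k, (-b) ^ (2 * k + 1) * a ^ (2 * m - (2 * k + 1)) * ((2 * m).choose (2 * k + 1) : ℝ)
      = - (b ^ (2 * k + 1) * a ^ (2 * m - (2 * k + 1)) * ((2 * m).choose (2 * k + 1) : ℝ)) := by
    intro k; rw [Odd.neg_pow ⟨k, rfl⟩]; ring
  simp only [this, Finset.sum_neg_distrib]
  rw [add_add_add_comm, add_neg_cancel, add_zero, ← Finset.sum_add_distrib, Finset.mul_sum]
  refine Finset.sum_congr rfl fun k _ => ?_
  rw [(even_two_mul k).neg_pow, ← pow_mul, ← pow_mul, Nat.mul_sub]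
  ring

theorem tangent_le_pow_two_mul (a b : ℝ) (m : ℕ) :
    a ^ (2 * m) - 2 * m * a ^ (2 * m - 1) * b ≤ (a - b) ^ (2 * m) := by
  rcases Nat.eq_zero_or_pos m with rfl | hm
  · simp
  have hev : Even (2 * m) := even_two_mul m
  rcases eq_or_ne a 0 with rfl | ha
  · rw [zero_pow (by omega), zero_pow (by omega)]
    simpa using hev.pow_nonneg (-b)
  have key : 1 + ((2 * m : ℕ) : ℝ) * (-(b / a)) ≤ (1 + -(b / a)) ^ (2 * m) := by
    by_cases h : -2 ≤ -(b / a)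
    · exact one_add_mul_le_pow h _
    · refine le_trans ?_ (hev.pow_nonneg _)
      push Not at h
      have : (1 : ℝ) ≤ m := by exact_mod_cast hm
      push_cast
      nlinarith
  have hpos : 0 < a ^ (2 * m) := hev.pow_pos ha
  have h := mul_le_mul_of_nonneg_left key hpos.le
  rw [← mul_pow] at h
  have e1 : a * (1 + -(b / a)) = a - b := by field_simp; ring
  have e2 : a ^ (2 * m) = a ^ (2 * m - 1) * a := by rw [← pow_succ]; congr 1; omega
  rw [e1] at h
  refine le_trans (le_of_eq ?_) h
  push_cast
  rw [e2]
  field_simp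
  ring

/-- The pointwise inequality behind `integral_sum_pow_le`: the term linear in `b` is kept apart
because its expectation vanishes when `b` is centred and independent of `a`. -/
theorem add_pow_two_mul_le (a b : ℝ) (m : ℕ) :
    (a + b) ^ (2 * m) ≤ 2 * m * a ^ (2 * m - 1) * b + (a ^ 2 + 4 * m * b ^ 2) ^ m := by
  have h1 := add_pow_two_mul_add_sub_pow_two_mul a b m
  have h2 := tangent_le_pow_two_mul a b m
  have h3 : 2 * ∑ k ∈ Finset.range (m + 1),
      (b ^ 2) ^ k * (a ^ 2) ^ (m - k) * ((2 * m).choose (2 * k))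
      ≤ a ^ (2 * m) + (a ^ 2 + 4 * m * b ^ 2) ^ m := by
    rw [add_comm (a ^ 2), add_pow, Finset.sum_range_succ', Finset.sum_range_succ', mul_add,
      Finset.mul_sum]
    have : ∀ k ∈ Finset.range m,
        2 * ((b ^ 2) ^ (k + 1) * (a ^ 2) ^ (m - (k + 1)) * ((2 * m).choose (2 * (k + 1)) : ℝ))
        ≤ (4 * m * b ^ 2) ^ (k + 1) * (a ^ 2) ^ (m - (k + 1)) * (m.choose (k + 1) : ℝ) := by
      intro k _
      have hc : ((2 * m).choose (2 * (k + 1)) : ℝ) ≤ m.choose (k + 1) * (2 * m) ^ (k + 1) := by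
        exact_mod_cast Nat.choose_two_mul_le m (k + 1)
      have h2k : (2 : ℝ) ≤ 2 ^ (k + 1) := le_self_pow₀ one_le_two (by omega)
      calc 2 * ((b ^ 2) ^ (k + 1) * (a ^ 2) ^ (m - (k + 1)) * ((2 * m).choose (2 * (k + 1)) : ℝ))
          ≤ 2 ^ (k + 1) * ((b ^ 2) ^ (k + 1) * (a ^ 2) ^ (m - (k + 1)) *
              (m.choose (k + 1) * (2 * m) ^ (k + 1))) := by gcongr
        _ = _ := by
          rw [show (4 * m * b ^ 2 : ℝ) = 2 * (2 * m) * b ^ 2 by ring,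
            mul_pow (2 * (2 * m) : ℝ), mul_pow (2 : ℝ) (2 * m : ℝ)]; ring
    have := Finset.sum_le_sum this
    simp only [mul_zero, pow_zero, Nat.choose_zero_right, Nat.sub_zero, one_mul, Nat.cast_one,
      mul_one, ← pow_mul] at this ⊢
    linarith
  linarith

theorem add_pow_le_weighted {u v i : ℝ} (hu : 0 ≤ u) (hv : 0 ≤ v) (hi : 0 < i) (m : ℕ) :
    (i * u + v) ^ m ≤ (i + 1) ^ m * ((i * u ^ m + v ^ m) / (i + 1)) := by
  have h := (convexOn_pow (𝕜 := ℝ) m).2 (Set.mem_Ici.2 hu) (Set.mem_Ici.2 hv)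
    (show 0 ≤ i / (i + 1) by positivity) (show 0 ≤ 1 / (i + 1) by positivity) (by field_simp)
  simp only [smul_eq_mul] at h
  calc (i * u + v) ^ m = (i + 1) ^ m * (i / (i + 1) * u + 1 / (i + 1) * v) ^ m := by
        rw [← mul_pow]; congr 1; field_simp
    _ ≤ (i + 1) ^ m * (i / (i + 1) * u ^ m + 1 / (i + 1) * v ^ m) := by gcongr
    _ = _ := by field_simp

theorem MeasureTheory.MemLp.integrable_pow_two_mul {Ω : Type*} [MeasurableSpace Ω] {μ : Measure Ω}
    [IsFiniteMeasure μ] {f : Ω → ℝ} {m : ℕ} (hf : MemLp f (2 * m : ℕ) μ) :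
    Integrable (fun ω => f ω ^ (2 * m)) μ := by
  have := hf.integrable_norm_pow'
  simpa [(even_two_mul m).pow_abs] using this

/-- A Marcinkiewicz–Zygmund inequality for even moments: a sum of `N` independent centred
variables behaves in `L^{2m}` like a Gaussian of variance `N`. -/
theorem integral_sum_pow_le {Ω ι : Type*} [MeasurableSpace Ω] {μ : Measure Ω}
    [IsProbabilityMeasure μ] {X : ι → Ω → ℝ} (hX : iIndepFun X μ) {m : ℕ} (hm : 1 ≤ m)
    (hL : ∀ i, MemLp (X i) (2 * m : ℕ) μ) (hmean : ∀ i, ∫ ω, X i ω ∂μ = 0) {β : ℝ}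
    (hβ : ∀ i, ∫ ω, X i ω ^ (2 * m) ∂μ ≤ β) (s : Finset ι) :
    ∫ ω, (∑ i ∈ s, X i ω) ^ (2 * m) ∂μ ≤ (4 * m * s.card) ^ m * β := by
  classical
  induction s using Finset.induction_on with
  | empty => simp [show m ≠ 0 by omega]
  | insert i s hi ih =>
    set S : Ω → ℝ := fun ω => ∑ i ∈ s, X i ω with hS
    have hSL : MemLp S (2 * m : ℕ) μ := memLp_finsetSum _ fun j _ => hL j
    have hmeas : ∀ j, AEMeasurable (X j) μ := fun j => (hL j).aestronglyMeasurable.aemeasurable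
    have hind : IndepFun S (X i) μ := by
      have := hX.indepFun_finsetSum_of_notMem₀ hmeas hi
      convert this using 1
      ext ω; simp [hS]
    have hind' : IndepFun (fun ω => S ω ^ (2 * m - 1)) (X i) μ :=
      hind.comp (φ := fun x => x ^ (2 * m - 1)) (ψ := id) (by fun_prop) measurable_id
    have hSi : Integrable (fun ω => S ω ^ (2 * m - 1)) μ := by
      have h1 : MemLp S ((2 * m - 1 : ℕ) : ENNReal) μ :=
        hSL.mono_exponent (by exact_mod_cast Nat.sub_le _ _)
      have h2 := h1.integrable_norm_pow'
      refine h2.mono' (h1.aestronglyMeasurable.pow _) (.of_forall fun ω => by simp)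
    have hXi : Integrable (X i) μ := (hL i).integrable (by exact_mod_cast (by omega : 1 ≤ 2 * m))
    have hcross : ∫ ω, 2 * m * S ω ^ (2 * m - 1) * X i ω ∂μ = 0 := by
      simp_rw [mul_assoc]
      rw [integral_const_mul, integral_const_mul,
        hind'.integral_fun_mul_eq_mul_integral hSi.aestronglyMeasurable hXi.aestronglyMeasurable,
        hmean]
      simp
    have hcrossint : Integrable (fun ω => 2 * m * S ω ^ (2 * m - 1) * X i ω) μ := by
      simp_rw [mul_assoc]
      exact ((hind'.integrable_mul hSi hXi).const_mul _).const_mul _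
    have hS2 := hSL.integrable_pow_two_mul
    have hX2 := (hL i).integrable_pow_two_mul
    have hm0 : (0 : ℝ) < m := by exact_mod_cast hm
    rw [Finset.card_insert_of_notMem hi]
    simp only [Finset.sum_insert hi]
    rcases s.eq_empty_or_nonempty with rfl | hne
    · have h0 : (0 : ℝ) ≤ ∫ ω, X i ω ^ (2 * m) ∂μ :=
        integral_nonneg fun ω => (even_two_mul m).pow_nonneg _
      have h1 : (1 : ℝ) ≤ (4 * m) ^ m := one_le_pow₀ (by
        have : (1 : ℝ) ≤ m := by exact_mod_cast hm
        linarith)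
      simp only [Finset.sum_empty, add_zero, Finset.card_empty, zero_add, Nat.cast_one, mul_one]
      nlinarith [hβ i]
    have hN : (0 : ℝ) < s.card := by exact_mod_cast hne.card_pos
    set N : ℝ := (s.card : ℝ) with hNdef
    have hpt : ∀ ω, (X i ω + S ω) ^ (2 * m) ≤ 2 * m * S ω ^ (2 * m - 1) * X i ω
        + (N + 1) ^ m * ((N * (S ω ^ (2 * m) / N ^ m) + (4 * m) ^ m * X i ω ^ (2 * m))
          / (N + 1)) := by
      intro ω
      have h1 := add_pow_two_mul_le (S ω) (X i ω) m
      have h2 := add_pow_le_weighted (u := S ω ^ 2 / N) (v := 4 * m * X i ω ^ 2)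
        (by positivity) (by positivity) hN m
      rw [mul_div_cancel₀ _ hN.ne', div_pow, mul_pow, ← pow_mul, ← pow_mul] at h2
      rw [add_comm (X i ω)]
      linarith
    have hR : Integrable (fun ω => (N + 1) ^ m * ((N * (S ω ^ (2 * m) / N ^ m)
        + (4 * m) ^ m * X i ω ^ (2 * m)) / (N + 1))) μ :=
      ((((hS2.div_const _).const_mul _).add (hX2.const_mul _)).div_const _).const_mul _
    calc ∫ ω, (X i ω + S ω) ^ (2 * m) ∂μ
        ≤ ∫ ω, (2 * m * S ω ^ (2 * m - 1) * X i ω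
          + (N + 1) ^ m * ((N * (S ω ^ (2 * m) / N ^ m) + (4 * m) ^ m * X i ω ^ (2 * m))
          / (N + 1))) ∂μ :=
          integral_mono ((hL i).add hSL).integrable_pow_two_mul (hcrossint.add hR) hpt
      _ = (N + 1) ^ m * ((N * ((∫ ω, S ω ^ (2 * m) ∂μ) / N ^ m)
          + (4 * m) ^ m * ∫ ω, X i ω ^ (2 * m) ∂μ) / (N + 1)) := by
          rw [integral_add hcrossint hR, hcross, zero_add, integral_const_mul, integral_div,
            integral_add ((hS2.div_const _).const_mul _) (hX2.const_mul _), integral_const_mul,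
            integral_div, integral_const_mul]
      _ ≤ (N + 1) ^ m * ((N * (((4 * m * N) ^ m * β) / N ^ m) + (4 * m) ^ m * β) / (N + 1)) := by
          gcongr
          exact hβ i
      _ = (4 * m * ((s.card + 1 : ℕ) : ℝ)) ^ m * β := by
          push_cast
          rw [← hNdef, mul_pow _ N, mul_pow _ (N + 1)]
          field_simp

/-! ### Gaussian moments -/

theorem integral_pow_two_mul_gaussianReal (k : ℕ) :
    ∫ x, x ^ (2 * k) ∂(gaussianReal 0 1) = (2 * k - 1).doubleFactorial := by
  have hsq : √(2 * Real.pi) = √2 * √Real.pi := Real.sqrt_mul (by norm_num) _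
  have hpi : √Real.pi ≠ 0 := by positivity
  have h2 : (2 : ℝ) ^ ((k : ℝ) + 1 / 2) = 2 ^ k * √2 := by
    rw [Real.rpow_add (by norm_num), Real.rpow_natCast, Real.sqrt_eq_rpow]
  have hIoi : ∫ x in Set.Ioi (0 : ℝ), (√(2 * Real.pi))⁻¹ * (x ^ (2 * k) * Real.exp (-x ^ 2 / 2))
      = (√(2 * Real.pi))⁻¹ * (2 ^ ((k : ℝ) + 1 / 2) * (1 / 2) * Real.Gamma (k + 1 / 2)) := by
    rw [integral_const_mul]
    congr 1
    have h := integral_rpow_mul_exp_neg_mul_rpow (p := 2) (q := 2 * k) (b := 1 / 2) two_pos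
      (by have : (0 : ℝ) ≤ k := k.cast_nonneg
          linarith) (by norm_num)
    rw [show ((2 * k + 1 : ℝ) / 2) = k + 1 / 2 by ring,
      show (-(2 * k + 1 : ℝ) / 2) = -(k + 1 / 2) by ring, one_div (2 : ℝ),
      Real.inv_rpow (by norm_num), Real.rpow_neg (by norm_num), inv_inv] at h
    rw [one_div, ← h]
    refine setIntegral_congr_fun measurableSet_Ioi fun x _ => ?_
    have e1 : x ^ (2 * k : ℝ) = x ^ (2 * k) := by
      rw [← Real.rpow_natCast]; push_cast; rfl
    simp only [e1, Real.rpow_two]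
    congr 2
    ring
  rw [integral_gaussianReal_eq_integral_smul one_ne_zero]
  have : ∀ x : ℝ, gaussianPDFReal 0 1 x • x ^ (2 * k) =
      (fun y : ℝ => (√(2 * Real.pi))⁻¹ * (y ^ (2 * k) * Real.exp (-y ^ 2 / 2))) |x| := by
    intro x
    simp only [gaussianPDFReal_def, (even_two_mul k).pow_abs, sq_abs, smul_eq_mul, sub_zero,
      NNReal.coe_one, mul_one]
    ring
  rw [integral_congr_ae (.of_forall this), integral_comp_abs (f := fun y : ℝ =>
    (√(2 * Real.pi))⁻¹ * (y ^ (2 * k) * Real.exp (-y ^ 2 / 2))), hIoi,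
    Real.Gamma_nat_add_half, hsq, h2]
  have : √(2 : ℝ) ≠ 0 := by positivity
  field_simp

/-- The inequality between the arithmetic and the geometric mean for `1, 3, …, 2k - 1`. -/
theorem doubleFactorial_two_mul_sub_one_le (k : ℕ) : (2 * k - 1).doubleFactorial ≤ k ^ k := by
  induction k with
  | zero => simp
  | succ k ih =>
    have h : (2 * (k + 1) - 1).doubleFactorial = (2 * k + 1) * (2 * k - 1).doubleFactorial := by
      rcases k with _ | k
      · simp
      · rw [show 2 * (k + 1 + 1) - 1 = (2 * k + 1) + 2 by omega, Nat.doubleFactorial_add_two]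
        rfl
    rw [h]
    have hb : k ^ (k + 1) + (k + 1) * k ^ k ≤ (k + 1) ^ (k + 1) := by
      have := pow_add_mul_le_add_pow (R := ℕ) (a := k) (b := 1) (by omega) (by omega) (k + 1)
      simpa using this
    calc (2 * k + 1) * (2 * k - 1).doubleFactorial ≤ (2 * k + 1) * k ^ k := by gcongr
      _ = k ^ (k + 1) + (k + 1) * k ^ k := by ring
      _ ≤ _ := hb

section inner

variable {Ω F : Type*} [MeasurableSpace Ω] {μ : Measure Ω}
  [NormedAddCommGroup F] [InnerProductSpace ℝ F] [FiniteDimensional ℝ F] [MeasurableSpace F]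
  [BorelSpace F]

theorem map_inner_stdGaussian {x : F} (hx : ‖x‖ = 1) :
    (stdGaussian F).map (fun y => ⟪x, y⟫) = gaussianReal 0 1 := by
  have h := IsGaussian.map_eq_gaussianReal (μ := stdGaussian F) (innerSL ℝ x)
  rw [variance_dual_stdGaussian, integral_strongDual_stdGaussian, innerSL_apply_norm, hx] at h
  simpa using h

theorem memLp_inner_stdGaussian {x : F} (hx : ‖x‖ = 1) (p : ℝ≥0) :
    MemLp (fun y => ⟪x, y⟫) p (stdGaussian F) := by
  have h : MemLp id p ((stdGaussian F).map (fun y => ⟪x, y⟫)) := by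
    rw [map_inner_stdGaussian hx]; exact memLp_id_gaussianReal p
  exact (memLp_map_measure_iff aestronglyMeasurable_id (by fun_prop)).1 h

theorem integral_inner_mul_inner_stdGaussian (x y : F) :
    ∫ z, ⟪x, z⟫ * ⟪y, z⟫ ∂(stdGaussian F) = ⟪x, y⟫ := by
  have h := covarianceBilin_apply_eq_cov (μ := stdGaussian F) IsGaussian.memLp_two_id x y
  have hL : ∀ x : F, MemLp (fun z => ⟪x, z⟫) 2 (stdGaussian F) := fun x =>
    (innerSL ℝ x).comp_memLp' IsGaussian.memLp_two_id
  have h0 : ∀ x : F, ∫ z, ⟪x, z⟫ ∂(stdGaussian F) = 0 := fun x =>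
    integral_strongDual_stdGaussian (innerSL ℝ x)
  rw [covarianceBilin_stdGaussian, covariance_eq_sub (hL x) (hL y), h0, zero_mul, sub_zero] at h
  exact h.symm

theorem integral_inner_pow_stdGaussian {x : F} (hx : ‖x‖ = 1) (k : ℕ) :
    ∫ z, ⟪x, z⟫ ^ (2 * k) ∂(stdGaussian F) = (2 * k - 1).doubleFactorial := by
  rw [← integral_pow_two_mul_gaussianReal, ← map_inner_stdGaussian hx,
    integral_map (by fun_prop) (by fun_prop)]

theorem holderTriple_two_mul (p : ENNReal) : ENNReal.HolderTriple (2 * p) (2 * p) p := by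
  constructor
  rw [ENNReal.mul_inv (by simp) (by simp), ← add_mul, ENNReal.inv_two_add_inv_two, one_mul]

theorem memLp_inner_mul_inner_stdGaussian {x y : F} (hx : ‖x‖ = 1) (hy : ‖y‖ = 1) (p : ℝ≥0) :
    MemLp (fun z => ⟪x, z⟫ * ⟪y, z⟫) p (stdGaussian F) := by
  have := holderTriple_two_mul p
  have h : ∀ {x : F}, ‖x‖ = 1 → MemLp (fun z => ⟪x, z⟫) (2 * p) (stdGaussian F) :=
    fun hx => by exact_mod_cast memLp_inner_stdGaussian hx (2 * p)
  exact (h hy).mul' (h hx)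

theorem integral_inner_mul_inner_pow_le {x y : F} (hx : ‖x‖ = 1) (hy : ‖y‖ = 1) (m : ℕ) :
    ∫ z, (⟪x, z⟫ * ⟪y, z⟫) ^ (2 * m) ∂(stdGaussian F)
      ≤ (2 * (2 * m) - 1).doubleFactorial := by
  have hi : ∀ {x : F}, ‖x‖ = 1 → Integrable (fun z => ⟪x, z⟫ ^ (2 * (2 * m))) (stdGaussian F) :=
    fun hx => MemLp.integrable_pow_two_mul (by
      exact_mod_cast memLp_inner_stdGaussian hx (2 * (2 * m) : ℕ))
  have hxy : Integrable (fun z => (⟪x, z⟫ * ⟪y, z⟫) ^ (2 * m)) (stdGaussian F) :=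
    MemLp.integrable_pow_two_mul (by
      exact_mod_cast memLp_inner_mul_inner_stdGaussian hx hy (2 * m : ℕ))
  calc ∫ z, (⟪x, z⟫ * ⟪y, z⟫) ^ (2 * m) ∂(stdGaussian F)
      ≤ ∫ z, (⟪x, z⟫ ^ (2 * (2 * m)) + ⟪y, z⟫ ^ (2 * (2 * m))) / 2 ∂(stdGaussian F) := by
        refine integral_mono hxy (((hi hx).add (hi hy)).div_const 2) fun z => ?_
        have := two_mul_le_add_sq (⟪x, z⟫ ^ (2 * m)) (⟪y, z⟫ ^ (2 * m))
        simp only [mul_pow]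
        rw [show 2 * (2 * m) = 2 * m * 2 by ring, pow_mul _ (2 * m) 2, pow_mul _ (2 * m) 2]
        linarith
    _ = _ := by
        rw [integral_div, integral_add (hi hx) (hi hy), integral_inner_pow_stdGaussian hx,
          integral_inner_pow_stdGaussian hy]
        ring

end inner

/-! ### Concentration of the random feature map -/

theorem memLp_finsetProd_of_forall {Ω ι : Type*} [MeasurableSpace Ω] {μ : Measure Ω}
    [IsFiniteMeasure μ] {f : ι → Ω → ℝ} (hf : ∀ i, ∀ p : ℝ≥0, MemLp (f i) p μ) (s : Finset ι)
    (p : ℝ≥0) : MemLp (fun ω => ∏ i ∈ s, f i ω) p μ := by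
  classical
  induction s using Finset.induction_on generalizing p with
  | empty => simpa using memLp_const (1 : ℝ)
  | insert i s hi ih =>
    have := holderTriple_two_mul p
    simp only [Finset.prod_insert hi]
    have h1 : MemLp (f i) (2 * p) μ := by exact_mod_cast hf i (2 * p)
    have h2 : MemLp (fun ω => ∏ i ∈ s, f i ω) (2 * p) μ := by exact_mod_cast ih (2 * p)
    exact h2.mul' h1

/-- If a doubly indexed family is independent, then so are its rows. -/
theorem iIndepFun_rows {Ω ι κ β : Type*} [MeasurableSpace Ω] {μ : Measure Ω} [Countable ι]
    [Countable κ] [MeasurableSpace β] {X : ι × κ → Ω → β}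
    (hX : iIndepFun X μ) (hm : ∀ p, AEMeasurable (X p) μ) :
    iIndepFun (fun i ω (j : κ) => X (i, j) ω) μ := by
  have := hX.isProbabilityMeasure
  have : ∀ p, IsProbabilityMeasure (μ.map (X p)) := fun p => Measure.isProbabilityMeasure_map (hm p)
  have hσ : iIndepFun (fun p : (_ : ι) × κ => X (p.1, p.2)) μ :=
    hX.precomp (Equiv.sigmaEquivProd ι κ).injective
  have h1 := (iIndepFun_iff_map_fun_eq_infinitePi_map₀' (fun p => hm _)).1 hσ
  rw [iIndepFun_iff_map_fun_eq_infinitePi_map₀' (fun i => aemeasurable_pi_iff.2 fun j => hm _)]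
  have h2 : ∀ i, μ.map (fun ω (j : κ) => X (i, j) ω)
      = Measure.infinitePi fun j => μ.map (X (i, j)) := fun i =>
    (iIndepFun_iff_map_fun_eq_infinitePi_map₀' (fun j => hm _)).1
      (hX.precomp (Prod.mk_right_injective i))
  simp_rw [h2]
  rw [← Measure.infinitePi_map_piCurry (fun i j => μ.map (X (i, j))), ← h1,
    AEMeasurable.map_map_of_aemeasurable (by fun_prop) (aemeasurable_pi_iff.2 fun p => hm _)]
  rfl

theorem sub_pow_two_mul_le (a b : ℝ) (m : ℕ) :
    (a - b) ^ (2 * m) ≤ 2 ^ (2 * m - 1) * (a ^ (2 * m) + b ^ (2 * m)) := by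
  have hev := even_two_mul m
  calc (a - b) ^ (2 * m) = |a - b| ^ (2 * m) := (hev.pow_abs _).symm
    _ ≤ (|a| + |b|) ^ (2 * m) := by gcongr; exact abs_sub a b
    _ ≤ 2 ^ (2 * m - 1) * (|a| ^ (2 * m) + |b| ^ (2 * m)) :=
      add_pow_le (abs_nonneg a) (abs_nonneg b) _
    _ = _ := by rw [hev.pow_abs, hev.pow_abs]

theorem measureReal_abs_ge_le {Ω : Type*} [MeasurableSpace Ω] {μ : Measure Ω} [IsFiniteMeasure μ]
    {f : Ω → ℝ} {m : ℕ} (hf : MemLp f (2 * m : ℕ) μ) {t : ℝ} (ht : 0 < t) :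
    μ.real {ω | t ≤ |f ω|} ≤ (∫ ω, f ω ^ (2 * m) ∂μ) / t ^ (2 * m) := by
  have hev := even_two_mul m
  rw [le_div_iff₀ (by positivity), mul_comm]
  refine le_trans ?_ (mul_meas_ge_le_integral_of_nonneg
    (.of_forall fun ω => hev.pow_nonneg _) hf.integrable_pow_two_mul (t ^ (2 * m)))
  refine mul_le_mul_of_nonneg_left (measureReal_mono fun ω hω => ?_) (by positivity)
  simp only [Set.mem_ofPred_eq] at hω ⊢
  rw [← hev.pow_abs (f ω)]
  gcongr

theorem inner_randomFeatureMap {d r D : ℕ} (w : Fin D → Fin r → EuclideanSpace ℝ (Fin d))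
    (x y : EuclideanSpace ℝ (Fin d)) :
    ⟪randomFeatureMap w x, randomFeatureMap w y⟫
      = (D : ℝ)⁻¹ * ∑ i, ∏ j, (⟪x, w i j⟫ * ⟪y, w i j⟫) := by
  have : (D : ℝ)⁻¹ = (√(D : ℝ))⁻¹ * (√(D : ℝ))⁻¹ := by
    rw [← mul_inv, Real.mul_self_sqrt (Nat.cast_nonneg D)]
  rw [PiLp.inner_apply]
  simp only [randomFeatureMap, RCLike.inner_apply, conj_trivial, this, Finset.prod_mul_distrib]
  rw [Finset.mul_sum]
  exact Finset.sum_congr rfl fun i _ => by ring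

section tail

variable {Ω : Type*} [MeasurableSpace Ω] {μ : Measure Ω} [IsProbabilityMeasure μ] {d r D : ℕ}
  {w : Fin D → Fin r → Ω → EuclideanSpace ℝ (Fin d)}

/-- Markov's inequality for the `2m`-th power of the deviation of the kernel estimate. Of the
constant `16 m`, the factor `4 m` comes from `integral_sum_pow_le` and the factor `4` from centring
the summands. -/
theorem measureReal_randomFeatureMap_le
    (hw : ∀ i j, HasLaw (w i j) (stdGaussian (EuclideanSpace ℝ (Fin d))) μ)
    (hind : iIndepFun (fun p : Fin D × Fin r => w p.1 p.2) μ) (hD : 0 < D)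
    {x y : EuclideanSpace ℝ (Fin d)} (hx : ‖x‖ = 1) (hy : ‖y‖ = 1) {m : ℕ} (hm : 1 ≤ m)
    {t : ℝ} (ht : 0 < t) :
    μ.real {ω | t / √(D : ℝ) ≤ |⟪x, y⟫ ^ r - ⟪randomFeatureMap (fun i j => w i j ω) x,
        randomFeatureMap (fun i j => w i j ω) y⟫|}
      ≤ (16 * m) ^ m * ((2 * (2 * m) - 1).doubleFactorial : ℝ) ^ r / t ^ (2 * m) := by
  set M : ℝ := ((2 * (2 * m) - 1).doubleFactorial : ℝ) with hM
  have hM1 : 1 ≤ M := by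
    rw [hM]; exact_mod_cast Nat.doubleFactorial_pos (2 * (2 * m) - 1)
  set φ : EuclideanSpace ℝ (Fin d) → ℝ := fun z => ⟪x, z⟫ * ⟪y, z⟫ with hφ
  have hφm : Measurable φ := by fun_prop
  have hwm : ∀ i j, AEMeasurable (w i j) μ := fun i j => (hw i j).aemeasurable
  -- the summands of the kernel estimate
  set Y : Fin D → Ω → ℝ := fun i ω => ∏ j, φ (w i j ω) with hY
  have hφL : ∀ i j, ∀ p : ℝ≥0, MemLp (fun ω => φ (w i j ω)) p μ := by
    intro i j p
    have h := memLp_inner_mul_inner_stdGaussian hx hy p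
    rw [← (hw i j).map_eq] at h
    exact (memLp_map_measure_iff hφm.aestronglyMeasurable (hwm i j)).1 h
  have hYL : ∀ i, ∀ p : ℝ≥0, MemLp (Y i) p μ := fun i p =>
    memLp_finsetProd_of_forall (hφL i) Finset.univ p
  have hrow : ∀ i, iIndepFun (w i) μ := fun i =>
    hind.precomp (g := fun j => (i, j)) (Prod.mk_right_injective i)
  have hprod : ∀ i, ∀ f : EuclideanSpace ℝ (Fin d) → ℝ, Measurable f →
      ∫ ω, ∏ j, f (w i j ω) ∂μ = (∫ z, f z ∂(stdGaussian (EuclideanSpace ℝ (Fin d)))) ^ r := by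
    intro i f hf
    rw [(hrow i).integral_fun_prod_comp (f := fun _ => f) (hwm i)
      (fun j => hf.aestronglyMeasurable)]
    have : ∀ j, ∫ ω, f (w i j ω) ∂μ = ∫ z, f z ∂(stdGaussian (EuclideanSpace ℝ (Fin d))) :=
      fun j => (hw i j).integral_comp hf.aestronglyMeasurable
    simp [this]
  have hYmean : ∀ i, ∫ ω, Y i ω ∂μ = ⟪x, y⟫ ^ r := fun i => by
    rw [hprod i φ hφm, integral_inner_mul_inner_stdGaussian]
  have hYmom : ∀ i, ∫ ω, Y i ω ^ (2 * m) ∂μ ≤ M ^ r := fun i => by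
    simp_rw [hY, ← Finset.prod_pow]
    rw [hprod i (fun z => φ z ^ (2 * m)) (by fun_prop)]
    gcongr
    · exact integral_nonneg fun z => (even_two_mul m).pow_nonneg _
    · exact integral_inner_mul_inner_pow_le hx hy m
  have hYind : iIndepFun Y μ := by
    have h := iIndepFun_rows hind (fun p => hwm p.1 p.2)
    exact h.comp (fun _ v => ∏ j, φ (v j)) (fun _ => by fun_prop)
  set ρ : ℝ := ⟪x, y⟫ ^ r with hρ
  have hρ1 : ρ ^ (2 * m) ≤ 1 := by
    rw [← (even_two_mul m).pow_abs, hρ, abs_pow]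
    refine pow_le_one₀ (by positivity) (pow_le_one₀ (abs_nonneg _) ?_)
    simpa [hx, hy] using abs_real_inner_le_norm x y
  -- the centred summands
  set X : Fin D → Ω → ℝ := fun i ω => Y i ω - ρ with hX
  have hXL : ∀ i, MemLp (X i) (2 * m : ℕ) μ := fun i => by
    have h : MemLp (Y i) (2 * m : ℕ) μ := by exact_mod_cast hYL i (2 * m : ℕ)
    exact h.sub (memLp_const ρ)
  have hYi : ∀ i, Integrable (Y i) μ := fun i => by
    exact memLp_one_iff_integrable.1 (by exact_mod_cast hYL i 1)
  have hXmean : ∀ i, ∫ ω, X i ω ∂μ = 0 := fun i => by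
    simp only [hX]
    rw [integral_sub (hYi i) (integrable_const _), hYmean]
    simp
  have hXmom : ∀ i, ∫ ω, X i ω ^ (2 * m) ∂μ ≤ 4 ^ m * M ^ r := fun i => by
    have hYint : Integrable (fun ω => Y i ω ^ (2 * m)) μ :=
      MemLp.integrable_pow_two_mul (by exact_mod_cast hYL i (2 * m : ℕ))
    have h1 : 1 ≤ M ^ r := one_le_pow₀ hM1
    calc ∫ ω, X i ω ^ (2 * m) ∂μ
        ≤ ∫ ω, 2 ^ (2 * m - 1) * (Y i ω ^ (2 * m) + ρ ^ (2 * m)) ∂μ :=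
          integral_mono (hXL i).integrable_pow_two_mul
            ((hYint.add (integrable_const _)).const_mul _)
            fun ω => sub_pow_two_mul_le _ _ m
      _ = 2 ^ (2 * m - 1) * (∫ ω, Y i ω ^ (2 * m) ∂μ + ρ ^ (2 * m)) := by
          rw [integral_const_mul, integral_add hYint (integrable_const _)]
          simp
      _ ≤ 2 ^ (2 * m - 1) * (M ^ r + M ^ r) := by
          gcongr
          · exact hYmom i
          · linarith
      _ = 4 ^ m * M ^ r := by
          rw [show (4 : ℝ) = 2 ^ 2 by norm_num, ← pow_mul]
          conv_rhs => rw [show 2 * m = 2 * m - 1 + 1 by omega, pow_succ]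
          ring
  have hXind : iIndepFun X μ := hYind.comp (fun _ v => v - ρ) (fun _ => by fun_prop)
  have hmain := integral_sum_pow_le hXind hm hXL hXmean hXmom Finset.univ
  have hD0 : (0 : ℝ) < D := by exact_mod_cast hD
  have hsq : √(D : ℝ) * √(D : ℝ) = D := Real.mul_self_sqrt hD0.le
  have hset : {ω | t / √(D : ℝ) ≤ |⟪x, y⟫ ^ r - ⟪randomFeatureMap (fun i j => w i j ω) x,
        randomFeatureMap (fun i j => w i j ω) y⟫|}
      = {ω | t * √(D : ℝ) ≤ |∑ i, X i ω|} := by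
    ext ω
    have e : ⟪x, y⟫ ^ r - ⟪randomFeatureMap (fun i j => w i j ω) x,
        randomFeatureMap (fun i j => w i j ω) y⟫ = -((∑ i, X i ω) / D) := by
      rw [inner_randomFeatureMap]
      simp only [hX, hY, hφ, Finset.sum_sub_distrib, Finset.sum_const, Finset.card_univ,
        Fintype.card_fin, nsmul_eq_mul]
      field_simp
      ring
    rw [Set.mem_ofPred_eq, Set.mem_ofPred_eq, e, abs_neg, abs_div, abs_of_pos hD0,
      div_le_div_iff₀ (by positivity) hD0]
    have hs : 0 < √(D : ℝ) := Real.sqrt_pos.2 hD0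
    rw [show t * (D : ℝ) = t * √(D : ℝ) * √(D : ℝ) by rw [mul_assoc, hsq]]
    exact mul_le_mul_iff_left₀ hs
  rw [hset]
  refine (measureReal_abs_ge_le (memLp_finsetSum _ fun i _ => hXL i) (by positivity)).trans ?_
  rw [div_le_div_iff₀ (by positivity) (by positivity)]
  have hDm : √(D : ℝ) ^ (2 * m) = (D : ℝ) ^ m := by rw [pow_mul, Real.sq_sqrt hD0.le]
  calc (∫ ω, (∑ i, X i ω) ^ (2 * m) ∂μ) * t ^ (2 * m)
      ≤ ((4 * m * (D : ℝ)) ^ m * (4 ^ m * M ^ r)) * t ^ (2 * m) := by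
        gcongr
        simpa using hmain
    _ = (16 * m) ^ m * M ^ r * (t * √(D : ℝ)) ^ (2 * m) := by
        rw [mul_pow t, hDm, show (16 * m : ℝ) = 4 * (4 * m) by ring, mul_pow 4 (4 * m : ℝ),
          mul_pow (4 * m : ℝ)]
        ring

end tail

/-- If `g` is a standard Gaussian and `L ≥ 1`, some moment of `g ^ 2` of order `2 m ≤ 2 L` shows
that `g ^ 2` exceeds `2 L` only with probability exponentially small in `L`. -/
theorem exists_doubleFactorial_le {L : ℝ} (hL : 1 ≤ L) :
    ∃ m : ℕ, 1 ≤ m ∧ (m : ℝ) ≤ L ∧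
      ((2 * (2 * m) - 1).doubleFactorial : ℝ) ≤ (2 * L) ^ (2 * m) * Real.exp (-(L / 8)) := by
  rcases lt_or_ge L 2 with h2 | h2
  · refine ⟨1, le_rfl, by simpa using hL, ?_⟩
    have h1 : (3 : ℝ) / 4 ≤ Real.exp (-(L / 8)) := by
      have := Real.add_one_le_exp (-(L / 8))
      linarith
    have h3 : (Nat.doubleFactorial (2 * (2 * 1) - 1) : ℝ) = 3 := by norm_num [Nat.doubleFactorial]
    rw [h3]
    have : (4 : ℝ) ≤ (2 * L) ^ (2 * 1) := by norm_num; nlinarith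
    calc (3 : ℝ) = 4 * (3 / 4) := by norm_num
      _ ≤ _ := by gcongr
  · set m := ⌊L / 2⌋₊ with hm
    have hle : (m : ℝ) ≤ L / 2 := Nat.floor_le (by linarith)
    have hlt : L / 2 < m + 1 := Nat.lt_floor_add_one _
    have h1 : 1 ≤ m := Nat.le_floor (by push_cast; linarith)
    have h1' : (1 : ℝ) ≤ m := by exact_mod_cast h1
    refine ⟨m, h1, by linarith, ?_⟩
    have hd : ((2 * (2 * m) - 1).doubleFactorial : ℝ) ≤ (2 * m) ^ (2 * m) := by
      exact_mod_cast doubleFactorial_two_mul_sub_one_le (2 * m)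
    have he : (1 : ℝ) / 4 ≤ Real.exp (-1) := by
      rw [Real.exp_neg, one_div]
      gcongr
      linarith [Real.exp_one_lt_d9]
    calc ((2 * (2 * m) - 1).doubleFactorial : ℝ) ≤ (2 * m) ^ (2 * m) := hd
      _ ≤ (2 * L * (1 / 2)) ^ (2 * m) := pow_le_pow_left₀ (by positivity) (by linarith) _
      _ = (2 * L) ^ (2 * m) * (1 / 4) ^ m := by rw [mul_pow, pow_mul (1 / 2 : ℝ)]; norm_num
      _ ≤ (2 * L) ^ (2 * m) * Real.exp (-1) ^ m := by gcongr
      _ ≤ (2 * L) ^ (2 * m) * Real.exp (-(L / 8)) := by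
        rw [← Real.exp_nat_mul]
        gcongr
        linarith

/-- The choice of the moment in Markov's inequality. The constant `C` does not depend on `r`: for
large `r` the product structure turns the gain of `exists_doubleFactorial_le` into a gain to the
power `r`, and for the finitely many other `r` the moment is taken large. -/
theorem exists_moment_bound {b : ℝ} (hb : 1 ≤ b) :
    ∃ C : ℝ, 0 < C ∧ ∀ (r : ℕ) (L : ℝ), 1 ≤ L → ∃ m : ℕ, 1 ≤ m ∧
      (16 * m) ^ m * ((2 * (2 * m) - 1).doubleFactorial : ℝ) ^ r
        / (C * (2 * L) ^ (r + 1)) ^ (2 * m) ≤ Real.exp (-(b * L)) := by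
  set R := ⌈8 * b⌉₊ with hR
  have hRb : 8 * b ≤ R := Nat.le_ceil _
  have h2b : 1 ≤ 2 * b := by linarith
  have hP : 1 ≤ (2 * b) ^ R := one_le_pow₀ h2b
  obtain ⟨C, hC⟩ : ∃ C : ℝ, C = 8 * b * (2 * b) ^ R := ⟨_, rfl⟩
  have hC8 : 8 ≤ C := by nlinarith
  refine ⟨C, by linarith, fun r L hL => ?_⟩
  have hC0 : 0 < C := by linarith
  have hL0 : 0 < L := by linarith
  have hsplit : ∀ m : ℕ, (C * (2 * L) ^ (r + 1)) ^ (2 * m)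
      = ((C * (2 * L)) ^ 2) ^ m * ((2 * L) ^ r) ^ (2 * m) := fun m => by
    rw [← pow_mul, ← mul_pow]
    congr 1
    ring
  rcases le_or_gt R r with hr | hr
  · obtain ⟨m, hm, hmL, hM⟩ := exists_doubleFactorial_le hL
    refine ⟨m, hm, ?_⟩
    rw [div_le_iff₀ (by positivity)]
    -- `R ≥ 8 b` factors `exp (-L / 8)` beat `exp (-b L)`; the factor `(16 m) ^ m` is
    -- absorbed by `C`
    have h1 : 16 * (m : ℝ) ≤ (C * (2 * L)) ^ 2 := by
      have : 8 * 2 ≤ C * (2 * L) := by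
        apply mul_le_mul hC8 (by linarith) (by norm_num) hC0.le
      nlinarith
    have h2 : Real.exp (-(L / 8)) ^ r ≤ Real.exp (-(b * L)) := by
      rw [← Real.exp_nat_mul]
      gcongr
      have : 8 * b ≤ r := hRb.trans (by exact_mod_cast hr)
      nlinarith
    calc (16 * (m : ℝ)) ^ m * ((2 * (2 * m) - 1).doubleFactorial : ℝ) ^ r
        ≤ ((C * (2 * L)) ^ 2) ^ m * ((2 * L) ^ (2 * m) * Real.exp (-(L / 8))) ^ r := by gcongr
      _ = Real.exp (-(L / 8)) ^ r * (C * (2 * L) ^ (r + 1)) ^ (2 * m) := by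
        rw [hsplit, mul_pow _ (Real.exp _), pow_right_comm]
        ring
      _ ≤ _ := by gcongr
  -- here the base of the `m`-th power is at most `exp (-1)`, by the choice of `C`, and `m ≥ b L`
  · set m := ⌈b * L⌉₊ with hm
    have hbL : 1 ≤ b * L := by nlinarith
    have h1 : b * L ≤ m := Nat.le_ceil _
    have h2 : (m : ℝ) ≤ 2 * (b * L) := by
      have := Nat.ceil_lt_add_one (show 0 ≤ b * L by linarith)
      linarith
    refine ⟨m, Nat.one_le_iff_ne_zero.2 (by positivity), ?_⟩
    rw [div_le_iff₀ (by positivity)]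
    have hd : ((2 * (2 * m) - 1).doubleFactorial : ℝ) ≤ (2 * m) ^ (2 * m) := by
      exact_mod_cast doubleFactorial_two_mul_sub_one_le (2 * m)
    have h3 : 16 * (m : ℝ) * (2 * b) ^ (2 * r) ≤ Real.exp (-1) * (C * (2 * L)) ^ 2 := by
      have he : (1 : ℝ) / 4 ≤ Real.exp (-1) := by
        rw [Real.exp_neg, one_div]
        gcongr
        linarith [Real.exp_one_lt_d9]
      calc 16 * (m : ℝ) * (2 * b) ^ (2 * r) ≤ 16 * (2 * (b * L)) * (2 * b) ^ (2 * R) := by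
            gcongr
        _ = 32 * (b * L) * (2 * b) ^ (2 * R) := by ring
        _ ≤ 64 * (b * L) ^ 2 * (2 * b) ^ (2 * R) := by
            have : b * L ≤ (b * L) ^ 2 := le_self_pow₀ hbL two_ne_zero
            gcongr
            linarith
        _ = 1 / 4 * (C * (2 * L)) ^ 2 := by rw [hC]; ring
        _ ≤ _ := by gcongr
    calc (16 * (m : ℝ)) ^ m * ((2 * (2 * m) - 1).doubleFactorial : ℝ) ^ r
        ≤ (16 * (m : ℝ)) ^ m * ((2 * (2 * (b * L))) ^ (2 * m)) ^ r := by
          gcongr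
          exact hd.trans (by gcongr)
      _ = (16 * (m : ℝ) * (2 * b) ^ (2 * r)) ^ m * ((2 * L) ^ r) ^ (2 * m) := by
          rw [show 2 * (2 * (b * L)) = 2 * b * (2 * L) by ring, mul_pow _ (2 * L),
            mul_pow _ _ r, mul_pow _ _ m]
          simp only [← pow_mul]
          ring_nf
      _ ≤ (Real.exp (-1) * (C * (2 * L)) ^ 2) ^ m * ((2 * L) ^ r) ^ (2 * m) := by gcongr
      _ = Real.exp (-1) ^ m * (C * (2 * L) ^ (r + 1)) ^ (2 * m) := by
          rw [mul_pow _ _ m, hsplit, mul_assoc]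
      _ ≤ Real.exp (-(b * L)) * (C * (2 * L) ^ (r + 1)) ^ (2 * m) := by
          rw [← Real.exp_nat_mul]
          gcongr
          linarith

/-! ### Exponential moments of squares of sub-Gaussian variables -/

theorem lintegral_exp_sq_div_four_gaussianReal :
    ∫⁻ g, ENNReal.ofReal (Real.exp (g ^ 2 / 4)) ∂(gaussianReal 0 1) = ENNReal.ofReal √2 := by
  have hpt : ∀ g : ℝ, gaussianPDF 0 1 g * ENNReal.ofReal (Real.exp (g ^ 2 / 4))
      = ENNReal.ofReal ((√(2 * Real.pi))⁻¹ * Real.exp (-(1 / 4) * g ^ 2)) := by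
    intro g
    rw [gaussianPDF, ← ENNReal.ofReal_mul (gaussianPDFReal_nonneg _ _ _), gaussianPDFReal_def]
    simp only [sub_zero, NNReal.coe_one, mul_one]
    rw [mul_assoc, ← Real.exp_add]
    congr 3
    ring
  rw [gaussianReal_of_var_ne_zero _ one_ne_zero,
    lintegral_withDensity_eq_lintegral_mul _ (measurable_gaussianPDF _ _) (by fun_prop)]
  simp only [Pi.mul_apply, hpt]
  rw [← ofReal_integral_eq_lintegral_ofReal
    ((integrable_exp_neg_mul_sq (by norm_num)).const_mul _) (.of_forall fun _ => by positivity),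
    integral_const_mul, integral_gaussian]
  congr 1
  rw [← Real.sqrt_inv, ← Real.sqrt_mul (by positivity)]
  congr 1
  have := Real.pi_ne_zero
  field_simp
  norm_num

section subgaussian

variable {Ω : Type*} [MeasurableSpace Ω] {μ : Measure Ω} [IsProbabilityMeasure μ]

/-- The square is linearised by a Gaussian variable: `exp (s ^ 2 / 2) = 𝔼 exp (s g)`. -/
theorem lintegral_exp_sq_le {Y : Ω → ℝ} {κ : ℝ≥0} (hκ : 0 < κ) (hY : HasSubgaussianMGF Y κ μ) :
    ∫⁻ ω, ENNReal.ofReal (Real.exp (Y ω ^ 2 / (4 * κ))) ∂μ ≤ ENNReal.ofReal √2 := by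
  have hκ' : (0 : ℝ) < κ := hκ
  set s : ℝ := √(1 / (2 * κ)) with hs
  have hs2 : s ^ 2 = 1 / (2 * κ) := Real.sq_sqrt (by positivity)
  have hlin : ∀ y : ℝ, ENNReal.ofReal (Real.exp (y ^ 2 / (4 * κ)))
      = ∫⁻ g, ENNReal.ofReal (Real.exp (s * g * y)) ∂(gaussianReal 0 1) := by
    intro y
    have h := congrFun (mgf_fun_id_gaussianReal (μ := 0) (v := 1)) (s * y)
    simp only [mgf, zero_mul, NNReal.coe_one, one_mul, zero_add] at h
    have e : ∀ g : ℝ, s * g * y = s * y * g := fun g => by ring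
    simp_rw [e]
    rw [← ofReal_integral_eq_lintegral_ofReal (integrable_exp_mul_gaussianReal _)
      (.of_forall fun _ => by positivity), h, mul_pow, hs2]
    congr 2
    field_simp
    norm_num
  simp_rw [hlin]
  rw [lintegral_lintegral_swap]
  · rw [← lintegral_exp_sq_div_four_gaussianReal]
    refine lintegral_mono fun g => ?_
    rw [← ofReal_integral_eq_lintegral_ofReal (hY.integrable_exp_mul _)
      (.of_forall fun _ => by positivity)]
    refine ENNReal.ofReal_le_ofReal ((hY.mgf_le _).trans (le_of_eq ?_))
    rw [mul_pow, hs2]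
    congr 1
    field_simp
    ring
  · have h1 : AEMeasurable (fun p : Ω × ℝ => Y p.1) (μ.prod (gaussianReal 0 1)) :=
      hY.aemeasurable.comp_fst
    have h2 : AEMeasurable (fun p : Ω × ℝ => p.2) (μ.prod (gaussianReal 0 1)) := by fun_prop
    exact ((h2.const_mul s).mul h1).exp.ennreal_ofReal

theorem integrable_exp_sq_and_integral_le {Y : Ω → ℝ} {κ : ℝ≥0} (hκ : 0 < κ)
    (hY : HasSubgaussianMGF Y κ μ) :
    Integrable (fun ω => Real.exp (Y ω ^ 2 / (4 * κ))) μ ∧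
      ∫ ω, Real.exp (Y ω ^ 2 / (4 * κ)) ∂μ ≤ √2 := by
  have hm : AEStronglyMeasurable (fun ω => Real.exp (Y ω ^ 2 / (4 * κ))) μ :=
    (((hY.aemeasurable.pow_const 2).div_const _).exp).aestronglyMeasurable
  have h := lintegral_exp_sq_le hκ hY
  refine ⟨(lintegral_ofReal_ne_top_iff_integrable hm (.of_forall fun _ => by positivity)).1
    (ne_top_of_le_ne_top ENNReal.ofReal_ne_top h), ?_⟩
  rw [integral_eq_lintegral_of_nonneg_ae (.of_forall fun _ => by positivity) hm]
  exact ENNReal.toReal_le_of_le_ofReal (by positivity) h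

theorem exp_le_one_add_add_sq_mul (x : ℝ) :
    Real.exp x ≤ 1 + x + x ^ 2 * Real.exp |x| := by
  have h1 : Real.exp x - 1 ≤ x * Real.exp x := by
    have := Real.add_one_le_exp (-x)
    have h := mul_le_mul_of_nonneg_right this (Real.exp_pos x).le
    rw [← Real.exp_add, neg_add_cancel, Real.exp_zero] at h
    linarith
  have h2 := Real.add_one_le_exp x
  rcases le_total 0 x with hx | hx
  · rw [abs_of_nonneg hx]
    nlinarith [mul_le_mul_of_nonneg_left h1 hx]
  · have : 1 ≤ Real.exp |x| := Real.one_le_exp (abs_nonneg x)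
    nlinarith [sq_nonneg x]

/-- A second-order expansion of the exponential whose remainder is integrable for a sub-Gaussian `y`
by `integrable_exp_sq_and_integral_le`: the factors `(y ^ 2 - 1) ^ 2` and `exp |l (y ^ 2 - 1)|`
use up half of the exponent `y ^ 2 / (4 κ)` each. -/
theorem exp_mul_sq_sub_one_le {κ l : ℝ} (hκ : 1 ≤ κ) (hl : |l| ≤ 1 / (8 * κ)) (y : ℝ) :
    Real.exp (l * (y ^ 2 - 1)) ≤ 1 + l * (y ^ 2 - 1)
      + 128 * κ ^ 2 * l ^ 2 * (4 / 3) * Real.exp (y ^ 2 / (4 * κ)) := by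
  have hκ0 : 0 < κ := by linarith
  set W := y ^ 2 - 1
  set v := |W| / (8 * κ) with hv
  have hv0 : 0 ≤ v := by positivity
  have hW2 : W ^ 2 = 64 * κ ^ 2 * v ^ 2 := by
    rw [hv, div_pow, sq_abs]; field_simp; norm_num
  have h1 : |l * W| ≤ v := by
    rw [abs_mul, hv, div_eq_inv_mul, ← one_div]
    gcongr
  have h2 : v ^ 2 ≤ 2 * Real.exp v := by
    have := Real.quadratic_le_exp_of_nonneg hv0
    linarith
  have h3 : Real.exp v * Real.exp v ≤ 4 / 3 * Real.exp (y ^ 2 / (4 * κ)) := by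
    have hWle : |W| ≤ y ^ 2 + 1 := by
      rw [abs_le]; constructor <;> simp only [W] <;> nlinarith [sq_nonneg y]
    have he : Real.exp (1 / 4) ≤ 4 / 3 := by
      have h := Real.add_one_le_exp (-(1 / 4 : ℝ))
      rw [Real.exp_neg] at h
      have h0 := Real.exp_pos (1 / 4 : ℝ)
      have := mul_le_mul_of_nonneg_right h h0.le
      rw [inv_mul_cancel₀ h0.ne'] at this
      linarith
    rw [← Real.exp_add]
    calc Real.exp (v + v) ≤ Real.exp (1 / 4 + y ^ 2 / (4 * κ)) := by
          refine Real.exp_le_exp.2 ?_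
          have : v + v = |W| / (4 * κ) := by rw [hv]; field_simp; ring
          rw [this]
          calc |W| / (4 * κ) ≤ (y ^ 2 + 1) / (4 * κ) := by gcongr
            _ = 1 / (4 * κ) + y ^ 2 / (4 * κ) := by ring
            _ ≤ 1 / 4 + y ^ 2 / (4 * κ) := by gcongr; linarith
      _ ≤ _ := by rw [Real.exp_add]; gcongr
  have h4 := exp_le_one_add_add_sq_mul (l * W)
  have h5 : (l * W) ^ 2 * Real.exp |l * W|
      ≤ 128 * κ ^ 2 * l ^ 2 * (4 / 3) * Real.exp (y ^ 2 / (4 * κ)) := by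
    calc (l * W) ^ 2 * Real.exp |l * W| ≤ (l * W) ^ 2 * Real.exp v := by gcongr
      _ = l ^ 2 * (64 * κ ^ 2) * v ^ 2 * Real.exp v := by rw [mul_pow, hW2]; ring
      _ ≤ l ^ 2 * (64 * κ ^ 2) * (2 * Real.exp v) * Real.exp v := by gcongr
      _ = l ^ 2 * (64 * κ ^ 2) * 2 * (Real.exp v * Real.exp v) := by ring
      _ ≤ l ^ 2 * (64 * κ ^ 2) * 2 * (4 / 3 * Real.exp (y ^ 2 / (4 * κ))) := by gcongr
      _ = _ := by ring
  linarith

theorem mgf_sq_sub_one_le {Y : Ω → ℝ} {κ : ℝ≥0} (hκ : 1 ≤ κ) (hY : HasSubgaussianMGF Y κ μ)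
    (hvar : ∫ ω, Y ω ^ 2 ∂μ = 1) {l : ℝ} (hl : |l| ≤ 1 / (8 * κ)) :
    Integrable (fun ω => Real.exp (l * (Y ω ^ 2 - 1))) μ ∧
      mgf (fun ω => Y ω ^ 2 - 1) μ l ≤ Real.exp (256 * κ ^ 2 * l ^ 2) := by
  have hκ' : (1 : ℝ) ≤ κ := hκ
  obtain ⟨hi, hle⟩ := integrable_exp_sq_and_integral_le (one_pos.trans_le hκ) hY
  have hY2 : Integrable (fun ω => Y ω ^ 2) μ := by
    have h : MemLp Y ((2 * 1 : ℕ) : ENNReal) μ := by exact_mod_cast hY.memLp 2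
    simpa using h.integrable_pow_two_mul
  have hW : Integrable (fun ω => Y ω ^ 2 - 1) μ := hY2.sub (integrable_const _)
  set c : ℝ := 128 * κ ^ 2 * l ^ 2 * (4 / 3) with hc
  have hlin : Integrable (fun ω => 1 + l * (Y ω ^ 2 - 1)) μ :=
    (integrable_const _).add (hW.const_mul l)
  have hbd : Integrable (fun ω => 1 + l * (Y ω ^ 2 - 1)
      + c * Real.exp (Y ω ^ 2 / (4 * κ))) μ :=
    hlin.add (hi.const_mul c)
  have hpt : ∀ ω, Real.exp (l * (Y ω ^ 2 - 1)) ≤ 1 + l * (Y ω ^ 2 - 1)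
      + c * Real.exp (Y ω ^ 2 / (4 * κ)) := fun ω => exp_mul_sq_sub_one_le hκ' hl (Y ω)
  have hint : Integrable (fun ω => Real.exp (l * (Y ω ^ 2 - 1))) μ := by
    refine hbd.mono' ((((hY.aemeasurable.pow_const 2).sub_const 1).const_mul
      l).exp).aestronglyMeasurable (.of_forall fun ω => ?_)
    rw [Real.norm_of_nonneg (by positivity)]
    exact hpt ω
  refine ⟨hint, ?_⟩
  calc mgf (fun ω => Y ω ^ 2 - 1) μ l
      ≤ ∫ ω, (1 + l * (Y ω ^ 2 - 1) + c * Real.exp (Y ω ^ 2 / (4 * κ))) ∂μ :=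
        integral_mono hint hbd hpt
    _ = 1 + c * ∫ ω, Real.exp (Y ω ^ 2 / (4 * κ)) ∂μ := by
        rw [integral_add hlin (hi.const_mul c),
          integral_add (integrable_const _) (hW.const_mul l), integral_const_mul,
          integral_const_mul, integral_sub hY2 (integrable_const _), hvar]
        simp
    _ ≤ 1 + c * (3 / 2) := by
        gcongr
        refine hle.trans ?_
        rw [Real.sqrt_le_left (by norm_num)]
        norm_num
    _ = 256 * κ ^ 2 * l ^ 2 + 1 := by rw [hc]; ring
    _ ≤ _ := Real.add_one_le_exp _

/-- Exponential moments of a `χ²`-type sum of squares of independent sub-Gaussian variables of unit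
variance. -/
theorem lintegral_exp_sum_sq_le {ι : Type*} [Fintype ι] {Y : ι → Ω → ℝ} {κ : ℝ≥0} (hκ : 1 ≤ κ)
    (hind : iIndepFun Y μ) (hY : ∀ k, HasSubgaussianMGF (Y k) κ μ)
    (hvar : ∀ k, ∫ ω, Y k ω ^ 2 ∂μ = 1) {l : ℝ} (hl : |l| ≤ 1 / (8 * κ)) :
    ∫⁻ ω, ENNReal.ofReal (Real.exp (l * ∑ k, (Y k ω ^ 2 - 1))) ∂μ
      ≤ ENNReal.ofReal (Real.exp (256 * κ ^ 2 * l ^ 2 * Fintype.card ι)) := by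
  have hind' : iIndepFun (fun k ω => Y k ω ^ 2 - 1) μ :=
    hind.comp (fun _ y => y ^ 2 - 1) (fun _ => by fun_prop)
  have hm : ∀ k, AEMeasurable (fun ω => Y k ω ^ 2 - 1) μ := fun k =>
    ((hY k).aemeasurable.pow_const 2).sub_const 1
  have hk := fun k => mgf_sq_sub_one_le hκ (hY k) (hvar k) hl
  have hsum := hind'.mgf_sum₀ hm Finset.univ (t := l)
  have hfun : (∑ k, fun ω => Y k ω ^ 2 - 1) = fun ω => ∑ k, (Y k ω ^ 2 - 1) := by
    ext ω; simp
  rw [hfun] at hsum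
  have hpos : 0 < mgf (fun ω => ∑ k, (Y k ω ^ 2 - 1)) μ l := by
    rw [hsum]
    exact Finset.prod_pos fun k _ => mgf_pos (hk k).1
  have hint : Integrable (fun ω => Real.exp (l * ∑ k, (Y k ω ^ 2 - 1))) μ := by
    by_contra h
    exact hpos.ne' (integral_undef h)
  rw [← ofReal_integral_eq_lintegral_ofReal hint (.of_forall fun _ => by positivity)]
  refine ENNReal.ofReal_le_ofReal (hsum.trans_le ?_)
  calc ∏ k, mgf (fun ω => Y k ω ^ 2 - 1) μ l
      ≤ ∏ _k : ι, Real.exp (256 * κ ^ 2 * l ^ 2) :=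
        Finset.prod_le_prod (fun k _ => mgf_nonneg) fun k _ => (hk k).2
    _ = _ := by
        rw [Finset.prod_const, Finset.card_univ, ← Real.exp_nat_mul]
        congr 1
        ring

end subgaussian

/-! ### Johnson–Lindenstrauss projections -/

theorem norm_toEuclideanLin_sq {D E : ℕ} (Q : Matrix (Fin E) (Fin D) ℝ)
    (u : EuclideanSpace ℝ (Fin D)) :
    ‖Matrix.toEuclideanLin Q u‖ ^ 2 = ∑ k, (∑ i, Q k i * u i) ^ 2 := by
  rw [EuclideanSpace.real_norm_sq_eq]
  rfl

theorem Measurable.norm_toEuclideanLin_sq {α : Type*} [MeasurableSpace α] {D E : ℕ}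
    {Q : α → Fin E → Fin D → ℝ} {u : α → EuclideanSpace ℝ (Fin D)} (hQ : Measurable Q)
    (hu : Measurable u) :
    Measurable fun p => ‖Matrix.toEuclideanLin (Matrix.of (Q p)) (u p)‖ ^ 2 := by
  simp_rw [_root_.norm_toEuclideanLin_sq, Matrix.of_apply]
  fun_prop

section subgaussian

variable {Ω : Type*} [MeasurableSpace Ω] {μ : Measure Ω} [IsProbabilityMeasure μ] {D E : ℕ}
  {Q : Fin E → Fin D → Ω → ℝ}

omit [IsProbabilityMeasure μ] in
theorem HasSubgaussianMGF_mono {X : Ω → ℝ} {c c' : ℝ≥0} (h : HasSubgaussianMGF X c μ)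
    (hc : c ≤ c') : HasSubgaussianMGF X c' μ where
  integrable_exp_mul := h.integrable_exp_mul
  mgf_le t := (h.mgf_le t).trans (by
    have : (c : ℝ) ≤ c' := hc
    gcongr)

omit [IsProbabilityMeasure μ] in
theorem HasSubgaussianMGF_const_mul {X : Ω → ℝ} {c : ℝ≥0} (h : HasSubgaussianMGF X c μ) (r : ℝ) :
    HasSubgaussianMGF (fun ω => r * X ω) ((r ^ 2).toNNReal * c) μ := by
  rw [Real.toNNReal_of_nonneg (sq_nonneg r)]
  exact h.const_mul r

/-- For a unit vector `u` the rows of `Q` give independent variables `√E (Q u)ₖ`, of unit variance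
and variance proxy `K`, to which `lintegral_exp_sum_sq_le` applies. The proxy is raised to `K + 1`
to have it at least `1`. -/
theorem IsSubgaussianProjection.lintegral_exp_le {K : ℝ≥0} (hQ : IsSubgaussianProjection K Q μ)
    (hE : 0 < E) {u : EuclideanSpace ℝ (Fin D)} (hu : ‖u‖ = 1) {t : ℝ}
    (ht : |t| ≤ E / (8 * (K + 1 : ℝ≥0))) :
    ∫⁻ ω, ENNReal.ofReal (Real.exp
        (t * (‖Matrix.toEuclideanLin (Matrix.of fun k i => Q k i ω) u‖ ^ 2 - 1))) ∂μ
      ≤ ENNReal.ofReal (Real.exp (256 * (K + 1 : ℝ≥0) ^ 2 * t ^ 2 / E)) := by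
  have hE0 : (0 : ℝ) < E := by exact_mod_cast hE
  have hu2 : ∑ i, u i ^ 2 = 1 := by rw [← EuclideanSpace.real_norm_sq_eq, hu, one_pow]
  have hm : ∀ k i, AEMeasurable (Q k i) μ := fun k i => (hQ.subgaussian k i).aemeasurable
  set Y : Fin E → Ω → ℝ := fun k ω => √(E : ℝ) * ∑ i, u i * Q k i ω with hY
  have hrow : ∀ k, iIndepFun (fun i ω => u i * Q k i ω) μ := fun k =>
    (hQ.indep.precomp (g := fun i => (k, i)) (Prod.mk_right_injective k)).comp
      (fun i q => u i * q) (fun _ => by fun_prop)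
  have hind : iIndepFun Y μ :=
    (iIndepFun_rows hQ.indep (fun p => hm p.1 p.2)).comp
      (fun _ v => √(E : ℝ) * ∑ i, u i * v i) (fun _ => by fun_prop)
  have hsub : ∀ k, HasSubgaussianMGF (Y k) (K + 1) μ := fun k => by
    have h1 := (HasSubgaussianMGF.sum_of_iIndepFun (hrow k) (s := Finset.univ)
      (fun i _ => HasSubgaussianMGF_const_mul (hQ.subgaussian k i) (u i)))
    refine HasSubgaussianMGF_mono (HasSubgaussianMGF_const_mul h1 √(E : ℝ)) ?_
    rw [← NNReal.coe_le_coe]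
    push_cast
    simp only [Real.coe_toNNReal _ (sq_nonneg _)]
    rw [← Finset.sum_mul, hu2, Real.sq_sqrt hE0.le, one_mul, mul_div_cancel₀ _ hE0.ne']
    linarith
  have hvar : ∀ k, ∫ ω, Y k ω ^ 2 ∂μ = 1 := fun k => by
    have hL : ∀ i, MemLp (Q k i) 2 μ := fun i => by
      exact_mod_cast (hQ.subgaussian k i).memLp 2
    have hLu : ∀ i, MemLp (fun ω => u i * Q k i ω) 2 μ := fun i => (hL i).const_mul _
    have hv : ∀ i, Var[fun ω => u i * Q k i ω; μ] = u i ^ 2 * (E : ℝ)⁻¹ := fun i => by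
      rw [variance_const_mul, variance_of_integral_eq_zero (hm k i) (hQ.mean k i),
        hQ.second_moment]
    have hsum := IndepFun.variance_sum (s := Finset.univ) (fun i _ => hLu i)
      (fun i _ j _ hij => (hrow k).indepFun hij)
    have hmean : ∫ ω, (∑ i, fun ω => u i * Q k i ω) ω ∂μ = 0 := by
      simp only [Finset.sum_apply]
      rw [integral_finsetSum _ fun i _ => (hLu i).integrable one_le_two]
      simp [integral_const_mul, hQ.mean]
    rw [variance_of_integral_eq_zero (Finset.aemeasurable_sum _ fun i _ => (hm k i).const_mul _)
      hmean] at hsum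
    simp only [hv, ← Finset.sum_mul, hu2, one_mul, Finset.sum_apply] at hsum
    simp only [hY, mul_pow]
    rw [integral_const_mul, hsum, Real.sq_sqrt hE0.le, mul_inv_cancel₀ hE0.ne']
  have hl : |t / E| ≤ 1 / (8 * (K + 1 : ℝ≥0)) := by
    rw [abs_div, abs_of_pos hE0, div_le_iff₀ hE0]
    exact ht.trans (le_of_eq (by ring))
  have h := lintegral_exp_sum_sq_le (le_add_self) hind hsub hvar hl
  rw [Fintype.card_fin] at h
  convert h using 5 with ω
  · rw [norm_toEuclideanLin_sq, Finset.sum_sub_distrib]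
    simp only [hY, mul_pow, Real.sq_sqrt hE0.le, ← Finset.mul_sum, Matrix.of_apply, mul_comm (u _)]
    simp only [Finset.sum_const, Finset.card_univ, Fintype.card_fin, nsmul_eq_mul]
    field_simp
  · field_simp

end subgaussian

section orthogonal

/-- The witness is the reflection that exchanges `u` and `v`. -/
theorem exists_orthogonal_toEuclideanLin_eq {D : ℕ} {u v : EuclideanSpace ℝ (Fin D)}
    (h : ‖u‖ = ‖v‖) :
    ∃ U ∈ Matrix.orthogonalGroup (Fin D) ℝ, Matrix.toEuclideanLin U u = v := by
  set f := (ℝ ∙ (u - v))ᗮ.reflection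
  set b := EuclideanSpace.basisFun (Fin D) ℝ
  refine ⟨LinearMap.toMatrix b.toBasis b.toBasis f.toLinearEquiv.toLinearMap,
    f.toMatrix_mem_unitaryGroup b b, ?_⟩
  rw [Matrix.toEuclideanLin_eq_toLin_orthonormal, Matrix.toLin_toMatrix]
  exact Submodule.reflection_sub h

theorem integral_norm_sq_stdGaussian (D : ℕ) :
    Integrable (fun g => ‖g‖ ^ 2) (stdGaussian (EuclideanSpace ℝ (Fin D))) ∧
      ∫ g, ‖g‖ ^ 2 ∂(stdGaussian (EuclideanSpace ℝ (Fin D))) = D := by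
  have hi : ∀ i : Fin D, Integrable (fun g => g i ^ 2) (stdGaussian (EuclideanSpace ℝ (Fin D))) :=
    fun i => ((EuclideanSpace.proj i : _ →L[ℝ] ℝ).comp_memLp'
      IsGaussian.memLp_two_id).integrable_sq
  simp_rw [EuclideanSpace.real_norm_sq_eq]
  refine ⟨integrable_finsetSum _ fun i _ => hi i, ?_⟩
  rw [integral_finsetSum _ fun i _ => hi i]
  have : ∀ i : Fin D, ∫ g, g i ^ 2 ∂(stdGaussian (EuclideanSpace ℝ (Fin D))) = 1 := fun i => by
    have h := integral_inner_mul_inner_stdGaussian (EuclideanSpace.basisFun (Fin D) ℝ i)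
      (EuclideanSpace.basisFun (Fin D) ℝ i)
    rw [real_inner_self_eq_norm_sq, OrthonormalBasis.norm_eq_one, one_pow] at h
    simp only [EuclideanSpace.basisFun_inner, ← pow_two] at h
    exact h
  simp [this]

/-- Jensen's inequality for `exp` and the squared norm of a Gaussian vector. -/
theorem exp_mul_le_lintegral_exp_norm_sq (D : ℕ) (c : ℝ) :
    ENNReal.ofReal (Real.exp (c * D))
      ≤ ∫⁻ g, ENNReal.ofReal (Real.exp (c * ‖g‖ ^ 2))
          ∂(stdGaussian (EuclideanSpace ℝ (Fin D))) := by
  obtain ⟨hi, hD⟩ := integral_norm_sq_stdGaussian D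
  by_cases hint : Integrable (fun g => Real.exp (c * ‖g‖ ^ 2))
      (stdGaussian (EuclideanSpace ℝ (Fin D)))
  · rw [← ofReal_integral_eq_lintegral_ofReal hint (.of_forall fun _ => by positivity)]
    refine ENNReal.ofReal_le_ofReal ?_
    have hlin : Integrable (fun g => Real.exp (c * D) * (1 + c * (‖g‖ ^ 2 - D)))
        (stdGaussian (EuclideanSpace ℝ (Fin D))) :=
      ((integrable_const _).add ((hi.sub (integrable_const _)).const_mul _)).const_mul _
    have h1 : Integrable (fun g => c * (‖g‖ ^ 2 - (D : ℝ)))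
        (stdGaussian (EuclideanSpace ℝ (Fin D))) := (hi.sub (integrable_const _)).const_mul _
    calc Real.exp (c * D) = ∫ g, Real.exp (c * D) * (1 + c * (‖g‖ ^ 2 - D))
          ∂(stdGaussian (EuclideanSpace ℝ (Fin D))) := by
          rw [integral_const_mul, integral_add (integrable_const _) h1, integral_const_mul,
            integral_sub hi (integrable_const _), hD]
          simp
      _ ≤ _ := by
          refine integral_mono hlin hint fun g => ?_
          have h := Real.add_one_le_exp (c * (‖g‖ ^ 2 - D))
          calc Real.exp (c * D) * (1 + c * (‖g‖ ^ 2 - D))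
              ≤ Real.exp (c * D) * Real.exp (c * (‖g‖ ^ 2 - D)) := by gcongr; linarith
            _ = Real.exp (c * ‖g‖ ^ 2) := by rw [← Real.exp_add]; congr 1; ring
  · have hm : Measurable fun g : EuclideanSpace ℝ (Fin D) => Real.exp (c * ‖g‖ ^ 2) := by fun_prop
    have htop := mt (lintegral_ofReal_ne_top_iff_integrable hm.aestronglyMeasurable
      (μ := stdGaussian (EuclideanSpace ℝ (Fin D))) (.of_forall fun _ => by positivity)).1 hint
    rw [not_not] at htop
    rw [htop]
    exact le_top

/-- A linear map `A` with `A Aᵀ = c` maps the standard Gaussian law to the law of `√c` times a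
standard Gaussian vector. -/
theorem map_stdGaussian_of_norm_adjoint {F G : Type*} [NormedAddCommGroup F]
    [InnerProductSpace ℝ F] [FiniteDimensional ℝ F] [MeasurableSpace F] [BorelSpace F]
    [NormedAddCommGroup G] [InnerProductSpace ℝ G] [FiniteDimensional ℝ G] [MeasurableSpace G]
    [BorelSpace G] (A : F →ₗ[ℝ] G) {c : ℝ} (hc : 0 ≤ c)
    (hA : ∀ t, ‖LinearMap.adjoint A t‖ ^ 2 = c * ‖t‖ ^ 2) :
    (stdGaussian F).map A = (stdGaussian G).map fun h => √c • h := by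
  have hAm : Measurable A := (LinearMap.continuous_of_finiteDimensional A).measurable
  have : IsProbabilityMeasure ((stdGaussian F).map A) :=
    Measure.isProbabilityMeasure_map hAm.aemeasurable
  have : IsProbabilityMeasure ((stdGaussian G).map fun h => √c • h) :=
    Measure.isProbabilityMeasure_map (by fun_prop)
  refine Measure.ext_of_charFun ?_
  ext t
  have h1 : charFun ((stdGaussian F).map A) t
      = charFun (stdGaussian F) (LinearMap.adjoint A t) := by
    rw [charFun_apply, charFun_apply, integral_map hAm.aemeasurable
      (Measurable.aestronglyMeasurable (by fun_prop))]
    simp_rw [LinearMap.adjoint_inner_right]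
  have h2 : charFun ((stdGaussian G).map fun h => √c • h) t = charFun (stdGaussian G) (√c • t) := by
    rw [charFun_apply, charFun_apply, integral_map (by fun_prop)
      (Measurable.aestronglyMeasurable (by fun_prop))]
    simp_rw [real_inner_smul_left, real_inner_smul_right]
  rw [h1, h2, charFun_stdGaussian, charFun_stdGaussian, norm_smul,
    Real.norm_of_nonneg (by positivity)]
  rw [← Complex.ofReal_pow, ← Complex.ofReal_pow, hA, mul_pow, Real.sq_sqrt hc]

theorem lintegral_exp_norm_toEuclideanLin_sq {D E : ℕ} {q : Matrix (Fin E) (Fin D) ℝ} {c : ℝ}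
    (hc : 0 ≤ c) (hq : q * qᵀ = c • (1 : Matrix (Fin E) (Fin E) ℝ)) (s : ℝ) :
    ∫⁻ g, ENNReal.ofReal (Real.exp (s * ‖Matrix.toEuclideanLin q g‖ ^ 2))
        ∂(stdGaussian (EuclideanSpace ℝ (Fin D)))
      = ∫⁻ h, ENNReal.ofReal (Real.exp (s * c * ‖h‖ ^ 2))
        ∂(stdGaussian (EuclideanSpace ℝ (Fin E))) := by
  have hadj : ∀ t, ‖LinearMap.adjoint (Matrix.toEuclideanLin q) t‖ ^ 2 = c * ‖t‖ ^ 2 := by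
    intro t
    have h1 : Matrix.toEuclideanLin q (LinearMap.adjoint (Matrix.toEuclideanLin q) t) = c • t := by
      rw [← Matrix.toEuclideanLin_conjTranspose_eq_adjoint,
        Matrix.conjTranspose_eq_transpose_of_trivial]
      ext k
      have : (q *ᵥ (qᵀ *ᵥ t.ofLp)) k = (c • t.ofLp) k := by
        rw [Matrix.mulVec_mulVec, hq, Matrix.smul_mulVec, Matrix.one_mulVec]
      exact this
    rw [← real_inner_self_eq_norm_sq, LinearMap.adjoint_inner_left, h1, real_inner_smul_right,
      real_inner_self_eq_norm_sq]
  have hmap := map_stdGaussian_of_norm_adjoint (Matrix.toEuclideanLin q) hc hadj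
  have hAm : Measurable (Matrix.toEuclideanLin q) :=
    (LinearMap.continuous_of_finiteDimensional (Matrix.toEuclideanLin q)).measurable
  have hf : Measurable fun y : EuclideanSpace ℝ (Fin E) =>
    ENNReal.ofReal (Real.exp (s * ‖y‖ ^ 2)) := by fun_prop
  rw [← lintegral_map hf hAm, hmap, lintegral_map hf (by fun_prop)]
  simp_rw [norm_smul, mul_pow, Real.norm_of_nonneg (Real.sqrt_nonneg c), Real.sq_sqrt hc, mul_assoc]

/-- The exponential moments of a random orthogonal projection are dominated by those of a Gaussian
projection. A Gaussian vector `g` is projected: by invariance `‖Q g‖` is distributed as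
`‖g‖ ‖Q u‖`, and Jensen's inequality in `‖g‖ ^ 2` gives the left-hand side as a lower bound, whereas
for fixed `Q` the vector `Q g` is Gaussian. -/
theorem lintegral_exp_orthogonal_le {D E : ℕ} (hE : 0 < E) (hED : E ≤ D)
    (ν : Measure (Fin E → Fin D → ℝ)) [IsProbabilityMeasure ν]
    (hrows : ∀ᵐ q ∂ν, Matrix.of q * (Matrix.of q)ᵀ
      = ((D : ℝ) / E) • (1 : Matrix (Fin E) (Fin E) ℝ))
    (hinv : ∀ U ∈ Matrix.orthogonalGroup (Fin D) ℝ,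
      ν.map (fun q k i => (Matrix.of q * U) k i) = ν)
    {u : EuclideanSpace ℝ (Fin D)} (hu : ‖u‖ = 1) (t : ℝ) :
    ∫⁻ q, ENNReal.ofReal (Real.exp (t * ‖Matrix.toEuclideanLin (Matrix.of q) u‖ ^ 2)) ∂ν
      ≤ ∫⁻ h, ENNReal.ofReal (Real.exp (t / E * ‖h‖ ^ 2))
        ∂(stdGaussian (EuclideanSpace ℝ (Fin E))) := by
  have hE0 : (0 : ℝ) < E := by exact_mod_cast hE
  have hD0 : (0 : ℝ) < D := by exact_mod_cast hE.trans_le hED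
  let γ := stdGaussian (EuclideanSpace ℝ (Fin D))
  obtain ⟨N, hN⟩ : ∃ N : (Fin E → Fin D → ℝ) → EuclideanSpace ℝ (Fin D) → ℝ,
      ∀ q g, N q g = ‖Matrix.toEuclideanLin (Matrix.of q) g‖ ^ 2 := ⟨_, fun _ _ => rfl⟩
  simp_rw [← hN]
  have hNm : Measurable (fun p : (Fin E → Fin D → ℝ) × EuclideanSpace ℝ (Fin D) => N p.1 p.2) := by
    simp_rw [hN]
    exact Measurable.norm_toEuclideanLin_sq measurable_fst measurable_snd
  have hNm1 : ∀ g, Measurable fun q => N q g := fun g =>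
    hNm.comp (measurable_id.prodMk measurable_const)
  have hNinv : ∀ s g, ∫⁻ q, ENNReal.ofReal (Real.exp (s * N q g)) ∂ν
      = ∫⁻ q, ENNReal.ofReal (Real.exp (s * (‖g‖ ^ 2 * N q u))) ∂ν := by
    intro s g
    obtain ⟨U, hU, hUg⟩ := exists_orthogonal_toEuclideanLin_eq (u := ‖g‖ • u) (v := g)
      (by rw [norm_smul, hu, norm_norm, mul_one])
    have hmeas : Measurable fun (q : Fin E → Fin D → ℝ) k i => (Matrix.of q * U) k i := by
      simp_rw [Matrix.mul_apply, Matrix.of_apply]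
      fun_prop
    have hmul : ∀ q, N (fun k i => (Matrix.of q * U) k i) (‖g‖ • u) = N q g := by
      intro q
      have : Matrix.toEuclideanLin (Matrix.of q * U) (‖g‖ • u)
          = Matrix.toEuclideanLin (Matrix.of q) g := by
        conv_rhs => rw [← hUg]
        ext k
        have := congrFun (Matrix.mulVec_mulVec (‖g‖ • u).ofLp (Matrix.of q) U) k
        exact this.symm
      simp only [hN]
      rw [← this]
      rfl
    have hsm : ∀ q, N q (‖g‖ • u) = ‖g‖ ^ 2 * N q u := fun q => by
      simp only [hN, map_smul, norm_smul, norm_norm, mul_pow]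
    have hf : Measurable fun q => ENNReal.ofReal (Real.exp (s * N q (‖g‖ • u))) :=
      ((hNm1 _).const_mul s).exp.ennreal_ofReal
    simp_rw [← hsm]
    conv_rhs => rw [← hinv U hU]
    rw [lintegral_map hf hmeas]
    simp_rw [hmul]
  have hswap : ∫⁻ g, ∫⁻ q, ENNReal.ofReal (Real.exp (t / D * N q g)) ∂ν ∂γ
      = ∫⁻ q, ∫⁻ g, ENNReal.ofReal (Real.exp (t / D * N q g)) ∂γ ∂ν :=
    lintegral_lintegral_swap
      (((hNm.comp measurable_swap).const_mul _).exp.ennreal_ofReal).aemeasurable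
  have hswap' : ∫⁻ g, ∫⁻ q, ENNReal.ofReal (Real.exp (t / D * (‖g‖ ^ 2 * N q u))) ∂ν ∂γ
      = ∫⁻ q, ∫⁻ g, ENNReal.ofReal (Real.exp (t / D * (‖g‖ ^ 2 * N q u))) ∂γ ∂ν := by
    refine lintegral_lintegral_swap (Measurable.aemeasurable ?_)
    have h1 : Measurable fun p : EuclideanSpace ℝ (Fin D) × (Fin E → Fin D → ℝ) => N p.2 u :=
      (hNm1 u).comp measurable_snd
    have h2 : Measurable fun p : EuclideanSpace ℝ (Fin D) × (Fin E → Fin D → ℝ) => ‖p.1‖ ^ 2 := by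
      fun_prop
    exact ((h2.mul h1).const_mul _).exp.ennreal_ofReal
  calc ∫⁻ q, ENNReal.ofReal (Real.exp (t * N q u)) ∂ν
      ≤ ∫⁻ q, ∫⁻ g, ENNReal.ofReal (Real.exp (t / D * (‖g‖ ^ 2 * N q u))) ∂γ ∂ν := by
        refine lintegral_mono fun q => ?_
        have h := exp_mul_le_lintegral_exp_norm_sq D (t / D * N q u)
        rw [show t / D * N q u * D = t * N q u by field_simp] at h
        refine h.trans (le_of_eq (lintegral_congr fun g => ?_))
        congr 2
        ring
    _ = ∫⁻ g, ∫⁻ q, ENNReal.ofReal (Real.exp (t / D * N q g)) ∂ν ∂γ := by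
        rw [← hswap']
        exact lintegral_congr fun g => (hNinv _ g).symm
    _ = ∫⁻ q, ∫⁻ g, ENNReal.ofReal (Real.exp (t / D * N q g)) ∂γ ∂ν := hswap
    _ = ∫⁻ _q, (∫⁻ h, ENNReal.ofReal (Real.exp (t / E * ‖h‖ ^ 2))
          ∂(stdGaussian (EuclideanSpace ℝ (Fin E)))) ∂ν := by
        refine lintegral_congr_ae ?_
        filter_upwards [hrows] with q hq
        have h := lintegral_exp_norm_toEuclideanLin_sq (by positivity) hq (t / D)
        rw [show t / D * ((D : ℝ) / E) = t / E by field_simp] at h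
        simp_rw [hN]
        exact h
    _ = _ := by simp

/-- Exponential moments of the `χ²` distribution with `E` degrees of freedom. -/
theorem lintegral_exp_norm_sq_stdGaussian_le {E : ℕ} {l : ℝ} (hl : |l| ≤ 1 / 8) :
    ∫⁻ h, ENNReal.ofReal (Real.exp (l * (‖h‖ ^ 2 - E)))
        ∂(stdGaussian (EuclideanSpace ℝ (Fin E)))
      ≤ ENNReal.ofReal (Real.exp (256 * l ^ 2 * E)) := by
  have hpres : ∀ k, MeasurePreserving (Function.eval k)
      (Measure.pi fun _ : Fin E => gaussianReal 0 1) (gaussianReal 0 1) := fun k =>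
    measurePreserving_eval _ k
  have hsub : HasSubgaussianMGF id 1 (gaussianReal 0 1) :=
    ⟨fun t => integrable_exp_mul_gaussianReal t, fun t => by rw [mgf_id_gaussianReal]; simp⟩
  have hind : iIndepFun (fun (k : Fin E) (v : Fin E → ℝ) => v k)
      (Measure.pi fun _ : Fin E => gaussianReal 0 1) :=
    iIndepFun_pi (X := fun _ x => x) fun _ => by fun_prop
  have h := lintegral_exp_sum_sq_le le_rfl hind
    (fun k => by
      have h := hsub
      rw [← (hpres k).map_eq] at h
      exact HasSubgaussianMGF.of_map (hpres k).measurable.aemeasurable h)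
    (fun k => by
      have h := integral_pow_two_mul_gaussianReal 1
      rw [← (hpres k).map_eq, integral_map (hpres k).measurable.aemeasurable (by fun_prop)] at h
      simpa using h) (l := l) (by simpa using hl)
  rw [← map_pi_eq_stdGaussian, lintegral_map (by fun_prop) (by fun_prop)]
  simp only [Fintype.card_fin, NNReal.coe_one, one_pow, mul_one, Finset.sum_sub_distrib,
    Finset.sum_const, Finset.card_univ, nsmul_eq_mul] at h
  simpa [EuclideanSpace.real_norm_sq_eq] using h

end orthogonal

/-! ### Tail bounds for the projection -/

section tail

variable {Ω : Type*} [MeasurableSpace Ω] {μ : Measure Ω} [IsProbabilityMeasure μ] {D E : ℕ}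
  {Q : Fin E → Fin D → Ω → ℝ}

theorem IsOrthogonalProjection.lintegral_exp_le (hQ : IsOrthogonalProjection Q μ)
    (hm : ∀ k i, AEMeasurable (Q k i) μ) (hE : 0 < E) (hED : E ≤ D)
    {u : EuclideanSpace ℝ (Fin D)} (hu : ‖u‖ = 1) {t : ℝ} (ht : |t| ≤ E / 8) :
    ∫⁻ ω, ENNReal.ofReal (Real.exp
        (t * (‖Matrix.toEuclideanLin (Matrix.of fun k i => Q k i ω) u‖ ^ 2 - 1))) ∂μ
      ≤ ENNReal.ofReal (Real.exp (256 * t ^ 2 / E)) := by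
  have hE0 : (0 : ℝ) < E := by exact_mod_cast hE
  have hQm : AEMeasurable (fun ω k i => Q k i ω) μ :=
    aemeasurable_pi_iff.2 fun k => aemeasurable_pi_iff.2 fun i => hm k i
  have : IsProbabilityMeasure (μ.map fun ω k i => Q k i ω) := Measure.isProbabilityMeasure_map hQm
  have hrows : ∀ᵐ q ∂(μ.map fun ω k i => Q k i ω), Matrix.of q * (Matrix.of q)ᵀ
      = ((D : ℝ) / E) • (1 : Matrix (Fin E) (Fin E) ℝ) := by
    refine (ae_map_iff hQm ?_).2 hQ.rows
    have : Continuous fun q : Fin E → Fin D → ℝ => Matrix.of q * (Matrix.of q)ᵀ := by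
      refine continuous_pi fun k => continuous_pi fun l => ?_
      simp_rw [Matrix.mul_apply, Matrix.transpose_apply, Matrix.of_apply]
      fun_prop
    exact (isClosed_eq this continuous_const).measurableSet
  have hinv : ∀ U ∈ Matrix.orthogonalGroup (Fin D) ℝ,
      (μ.map fun ω k i => Q k i ω).map (fun q k i => (Matrix.of q * U) k i)
        = μ.map fun ω k i => Q k i ω := by
    intro U hU
    have hmeas : Measurable fun (q : Fin E → Fin D → ℝ) k i => (Matrix.of q * U) k i := by
      simp_rw [Matrix.mul_apply, Matrix.of_apply]
      fun_prop
    rw [AEMeasurable.map_map_of_aemeasurable hmeas.aemeasurable hQm]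
    exact (hQ.invariant U hU).map_eq
  have hNm : Measurable fun q : Fin E → Fin D → ℝ =>
      ‖Matrix.toEuclideanLin (Matrix.of q) u‖ ^ 2 :=
    Measurable.norm_toEuclideanLin_sq measurable_id measurable_const
  have h1 := lintegral_exp_orthogonal_le hE hED _ hrows hinv hu t
  rw [lintegral_map' (hNm.const_mul t).exp.ennreal_ofReal.aemeasurable hQm] at h1
  have h2 := lintegral_exp_norm_sq_stdGaussian_le (E := E) (l := t / E) (by
    rw [abs_div, abs_of_pos hE0, div_le_iff₀ hE0]
    linarith)
  have e1 : ∀ y : ℝ, ENNReal.ofReal (Real.exp (t * (y - 1)))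
      = ENNReal.ofReal (Real.exp (t * y)) * ENNReal.ofReal (Real.exp (-t)) := fun y => by
    rw [← ENNReal.ofReal_mul (by positivity), ← Real.exp_add]
    congr 2
    ring
  have e2 : ∀ y : ℝ, ENNReal.ofReal (Real.exp (t / E * (y - E)))
      = ENNReal.ofReal (Real.exp (t / E * y)) * ENNReal.ofReal (Real.exp (-t)) := fun y => by
    rw [← ENNReal.ofReal_mul (by positivity), ← Real.exp_add]
    congr 2
    field_simp
    ring
  have e3 : 256 * (t / E) ^ 2 * E = 256 * t ^ 2 / E := by field_simp
  simp_rw [e2, e3] at h2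
  simp_rw [e1]
  rw [lintegral_mul_const' _ _ ENNReal.ofReal_ne_top] at h2 ⊢
  exact (mul_le_mul_left h1 _).trans h2

theorem IsJohnsonLindenstrauss.lintegral_exp_le {K : ℝ≥0} (hQ : IsJohnsonLindenstrauss K Q μ)
    (hm : ∀ k i, AEMeasurable (Q k i) μ) (hE : 0 < E) (hED : E ≤ D)
    {u : EuclideanSpace ℝ (Fin D)} (hu : ‖u‖ = 1) {t : ℝ}
    (ht : |t| ≤ E / (8 * (K + 1 : ℝ≥0))) :
    ∫⁻ ω, ENNReal.ofReal (Real.exp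
        (t * (‖Matrix.toEuclideanLin (Matrix.of fun k i => Q k i ω) u‖ ^ 2 - 1))) ∂μ
      ≤ ENNReal.ofReal (Real.exp (256 * (K + 1 : ℝ≥0) ^ 2 * t ^ 2 / E)) := by
  rcases hQ with hQ | hQ
  · exact hQ.lintegral_exp_le hE hu ht
  · have hK : (1 : ℝ) ≤ (K + 1 : ℝ≥0) := by push_cast; linarith [K.coe_nonneg]
    refine (hQ.lintegral_exp_le hm hE hED hu (ht.trans ?_)).trans (ENNReal.ofReal_le_ofReal ?_)
    · gcongr
      linarith
    · gcongr
      nlinarith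

/-- The Johnson–Lindenstrauss lemma for a single vector. The hypothesis `L ≤ E` keeps the deviation
in the Gaussian regime of Bernstein's inequality. -/
theorem IsJohnsonLindenstrauss.measure_norm_sq_le {K : ℝ≥0} (hQ : IsJohnsonLindenstrauss K Q μ)
    (hm : ∀ k i, AEMeasurable (Q k i) μ) (hE : 0 < E) (hED : E ≤ D) {L : ℝ} (hL : 0 ≤ L)
    (hLE : L ≤ E) (b : ℝ) (u : EuclideanSpace ℝ (Fin D)) :
    μ {ω | 8 * (K + 1 : ℝ≥0) * (b + 4) * (√L / √(E : ℝ)) * ‖u‖ ^ 2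
        < |‖Matrix.toEuclideanLin (Matrix.of fun k i => Q k i ω) u‖ ^ 2 - ‖u‖ ^ 2|}
      ≤ ENNReal.ofReal (2 * Real.exp (-(b * L))) := by
  have hE0 : (0 : ℝ) < E := by exact_mod_cast hE
  have hK : (0 : ℝ) < (K + 1 : ℝ≥0) := by positivity
  obtain ⟨κ, hκ⟩ : ∃ κ : ℝ, κ = (K + 1 : ℝ≥0) := ⟨_, rfl⟩
  rw [← hκ] at hK ⊢
  rcases eq_or_ne u 0 with rfl | hu
  · simp
  have hu0 : 0 < ‖u‖ := norm_pos_iff.2 hu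
  set v : EuclideanSpace ℝ (Fin D) := ‖u‖⁻¹ • u with hv
  have hv1 : ‖v‖ = 1 := by rw [hv, norm_smul, norm_inv, norm_norm, inv_mul_cancel₀ hu0.ne']
  set T : Ω → ℝ := fun ω =>
    ‖Matrix.toEuclideanLin (Matrix.of fun k i => Q k i ω) v‖ ^ 2 - 1 with hT
  have hTm : AEMeasurable T μ := by
    have hQm : AEMeasurable (fun ω k i => Q k i ω) μ :=
      aemeasurable_pi_iff.2 fun k => aemeasurable_pi_iff.2 fun i => hm k i
    exact ((Measurable.norm_toEuclideanLin_sq measurable_id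
      measurable_const).comp_aemeasurable hQm).sub_const 1
  have hscale : ∀ ω, ‖Matrix.toEuclideanLin (Matrix.of fun k i => Q k i ω) u‖ ^ 2 - ‖u‖ ^ 2
      = T ω * ‖u‖ ^ 2 := fun ω => by
    simp only [hT, hv, map_smul, norm_smul, norm_inv, norm_norm]
    field_simp
  set ε : ℝ := 8 * κ * (b + 4) * (√L / √(E : ℝ)) with hε
  -- the Chernoff parameter; `L ≤ E` makes it admissible for the bound on exponential moments
  set t : ℝ := √L * √(E : ℝ) / (8 * κ) with ht
  have hsE : 0 < √(E : ℝ) := Real.sqrt_pos.2 hE0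
  have hEE : √(E : ℝ) ^ 2 = E := Real.sq_sqrt hE0.le
  have hLL : √L ^ 2 = L := Real.sq_sqrt hL
  have ht0 : 0 ≤ t := by positivity
  have htE : t ≤ E / (8 * κ) := by
    rw [ht]
    gcongr
    calc √L * √(E : ℝ) ≤ √(E : ℝ) * √(E : ℝ) := by gcongr
      _ = E := by rw [← pow_two, hEE]
  have htε : t * ε = (b + 4) * L := by
    rw [ht, hε]
    field_simp
    rw [hLL]
    ring
  have ht2 : 256 * κ ^ 2 * t ^ 2 / E = 4 * L := by
    rw [ht, div_pow, mul_pow, hLL, hEE]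
    field_simp
    ring
  -- Chernoff's bound for each of the two tails
  have hchern : ∀ σ : ℝ, |σ| = 1 → μ {ω | ε < σ * T ω} ≤ ENNReal.ofReal (Real.exp (-(b * L))) := by
    intro σ hσ
    have hσ2 : σ ^ 2 = 1 := by rw [← sq_abs, hσ, one_pow]
    have h := hQ.lintegral_exp_le hm hE hED hv1 (t := t * σ)
      (by rw [← hκ, abs_mul, hσ, mul_one, abs_of_nonneg ht0]; exact htE)
    rw [← hκ, mul_pow, hσ2, mul_one, ht2] at h
    have hmk := meas_ge_le_lintegral_div (μ := μ)
      (f := fun ω => ENNReal.ofReal (Real.exp (t * σ * T ω)))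
      (hTm.const_mul _).exp.ennreal_ofReal (ε := ENNReal.ofReal (Real.exp (t * ε)))
      (by simpa using Real.exp_pos _) ENNReal.ofReal_ne_top
    calc μ {ω | ε < σ * T ω}
        ≤ μ {ω | ENNReal.ofReal (Real.exp (t * ε)) ≤ ENNReal.ofReal (Real.exp (t * σ * T ω))} := by
          refine measure_mono fun ω hω => ?_
          simp only [Set.mem_ofPred_eq] at hω ⊢
          rw [mul_assoc t σ]
          gcongr
      _ ≤ ENNReal.ofReal (Real.exp (4 * L)) / ENNReal.ofReal (Real.exp (t * ε)) :=
          hmk.trans (by gcongr)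
      _ = ENNReal.ofReal (Real.exp (-(b * L))) := by
          rw [← ENNReal.ofReal_div_of_pos (by positivity), ← Real.exp_sub, htε]
          congr 2
          ring
  calc _ ≤ μ ({ω | ε < 1 * T ω} ∪ {ω | ε < -1 * T ω}) := by
        refine measure_mono fun ω hω => ?_
        simp only [Set.mem_ofPred_eq, Set.mem_union] at hω ⊢
        rw [hscale, abs_mul, abs_of_pos (show 0 < ‖u‖ ^ 2 by positivity),
          mul_lt_mul_iff_left₀ (by positivity), lt_abs] at hω
        simpa using hω
    _ ≤ ENNReal.ofReal (Real.exp (-(b * L))) + ENNReal.ofReal (Real.exp (-(b * L))) :=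
        (measure_union_le _ _).trans (add_le_add (hchern 1 (by simp)) (hchern (-1) (by simp)))
    _ = _ := by rw [← ENNReal.ofReal_add (by positivity) (by positivity), two_mul]

/-- The vector in the Johnson–Lindenstrauss lemma may be random, as long as it is independent of
the projection. -/
theorem IsJohnsonLindenstrauss.measureReal_norm_sq_le {K : ℝ≥0}
    (hQ : IsJohnsonLindenstrauss K Q μ) (hm : ∀ k i, AEMeasurable (Q k i) μ) (hE : 0 < E)
    (hED : E ≤ D) {L : ℝ} (hL : 0 ≤ L) (hLE : L ≤ E) (b : ℝ) {β : Type*} [MeasurableSpace β]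
    {W : Ω → β} (hW : AEMeasurable W μ) (hind : IndepFun W (fun ω k i => Q k i ω) μ)
    {f : β → EuclideanSpace ℝ (Fin D)} (hf : Measurable f) :
    μ.real {ω | 8 * (K + 1 : ℝ≥0) * (b + 4) * (√L / √(E : ℝ)) * ‖f (W ω)‖ ^ 2
        < |‖Matrix.toEuclideanLin (Matrix.of fun k i => Q k i ω) (f (W ω))‖ ^ 2
          - ‖f (W ω)‖ ^ 2|}
      ≤ 2 * Real.exp (-(b * L)) := by
  have hQm : AEMeasurable (fun ω k i => Q k i ω) μ :=
    aemeasurable_pi_iff.2 fun k => aemeasurable_pi_iff.2 fun i => hm k i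
  obtain ⟨c, hc⟩ : ∃ c : ℝ, c = 8 * (K + 1 : ℝ≥0) * (b + 4) * (√L / √(E : ℝ)) := ⟨_, rfl⟩
  have hpoint := hQ.measure_norm_sq_le hm hE hED hL hLE b
  rw [← hc] at hpoint ⊢
  have hfs : Measurable fun p : β × (Fin E → Fin D → ℝ) => f p.1 := hf.comp measurable_fst
  have hN : Measurable fun p : β × (Fin E → Fin D → ℝ) =>
      ‖Matrix.toEuclideanLin (Matrix.of p.2) (f p.1)‖ ^ 2 :=
    Measurable.norm_toEuclideanLin_sq measurable_snd hfs
  have hn : Measurable fun p : β × (Fin E → Fin D → ℝ) => ‖f p.1‖ ^ 2 := hfs.norm.pow_const 2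
  set S : Set (β × (Fin E → Fin D → ℝ)) := {p | c * ‖f p.1‖ ^ 2
    < |‖Matrix.toEuclideanLin (Matrix.of p.2) (f p.1)‖ ^ 2 - ‖f p.1‖ ^ 2|} with hS
  have hSm : MeasurableSet S := by
    have h := (hN.sub hn).norm
    simp only [Real.norm_eq_abs] at h
    exact measurableSet_lt (hn.const_mul c) h
  have hprob : IsProbabilityMeasure (μ.map W) := Measure.isProbabilityMeasure_map hW
  have key : μ ((fun ω => (W ω, fun k i => Q k i ω)) ⁻¹' S)
      ≤ ENNReal.ofReal (2 * Real.exp (-(b * L))) := by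
    rw [← Measure.map_apply_of_aemeasurable (hW.prodMk hQm) hSm,
      hind.map_prod_eq_prod_map_map hW hQm, Measure.prod_apply hSm]
    calc _ ≤ ∫⁻ _x, ENNReal.ofReal (2 * Real.exp (-(b * L))) ∂(μ.map W) := by
          refine lintegral_mono fun x => ?_
          rw [Measure.map_apply_of_aemeasurable hQm (measurable_prodMk_left hSm)]
          exact hpoint (f x)
      _ = _ := by simp
  exact ENNReal.toReal_le_of_le_ofReal (by positivity) key

end tail

/-! ### The compact feature map -/

theorem measurable_randomFeatureMap {d r D : ℕ} (x : EuclideanSpace ℝ (Fin d)) :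
    Measurable fun w : Fin D → Fin r → EuclideanSpace ℝ (Fin d) => randomFeatureMap w x := by
  refine (WithLp.measurable_toLp 2 (Fin D → ℝ)).comp ?_
  fun_prop

/-- If a linear map almost preserves the norms of `z + z'` and `z - z'`, then it almost preserves
their inner product. -/
theorem abs_inner_sub_inner_map_le {F G : Type*} [NormedAddCommGroup F] [InnerProductSpace ℝ F]
    [NormedAddCommGroup G] [InnerProductSpace ℝ G] (A : F →ₗ[ℝ] G) {ε : ℝ} {z z' : F}
    (h1 : |‖A (z + z')‖ ^ 2 - ‖z + z'‖ ^ 2| ≤ ε * ‖z + z'‖ ^ 2)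
    (h2 : |‖A (z - z')‖ ^ 2 - ‖z - z'‖ ^ 2| ≤ ε * ‖z - z'‖ ^ 2) :
    |⟪z, z'⟫ - ⟪A z, A z'⟫| ≤ ε * ((‖z‖ ^ 2 + ‖z'‖ ^ 2) / 2) := by
  rw [map_add, norm_add_sq_real, norm_add_sq_real, abs_le] at h1
  rw [map_sub, norm_sub_sq_real, norm_sub_sq_real, abs_le] at h2
  rw [abs_le]
  constructor <;> linarith

theorem mainTheorem1 (a : ℝ) (ha : 0 < a) (K : ℝ≥0) :
    ∃ C : ℝ, 0 < C ∧
      ∀ (r d n D E : ℕ), 3 ≤ n → E ≤ D → Real.log n ≤ E →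
      ∀ X : Finset (EuclideanSpace ℝ (Fin d)), X.card ≤ n → (∀ x ∈ X, ‖x‖ = 1) →
      ∀ (Ω : Type*) [MeasurableSpace Ω] (μ : Measure Ω) [IsProbabilityMeasure μ]
        (w : Fin D → Fin r → Ω → EuclideanSpace ℝ (Fin d)) (Q : Fin E → Fin D → Ω → ℝ),
        (∀ i j, HasLaw (w i j) (stdGaussian (EuclideanSpace ℝ (Fin d))) μ) →
        iIndepFun (fun p : Fin D × Fin r => w p.1 p.2) μ →
        (∀ k i, AEMeasurable (Q k i) μ) →
        IsJohnsonLindenstrauss K Q μ →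
        IndepFun (fun ω i j => w i j ω) (fun ω k i => Q k i ω) μ →
        1 - (n : ℝ) ^ (-a) ≤ μ.real {ω | ∀ x ∈ X, ∀ x' ∈ X,
          |⟪x, x'⟫ ^ r
              - ⟪craftMap (fun i j => w i j ω) (Matrix.of fun k i => Q k i ω) x,
                  craftMap (fun i j => w i j ω) (Matrix.of fun k i => Q k i ω) x'⟫|
            ≤ C * (2 ^ (r + 1) * Real.log n ^ (r + 1) / √(D : ℝ) + √(Real.log n) / √(E : ℝ))} := by
  -- exponent for the single events: a union bound over `n ^ 2` pairs has to be absorbed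
  obtain ⟨b, hb⟩ : ∃ b : ℝ, b = a + 4 := ⟨_, rfl⟩
  obtain ⟨C₁, hC₁, hmom⟩ := exists_moment_bound (show 1 ≤ b by linarith)
  obtain ⟨C₂, hC₂⟩ : ∃ C₂ : ℝ, C₂ = 8 * (K + 1 : ℝ≥0) * (b + 4) := ⟨_, rfl⟩
  have hC₂0 : 0 < C₂ := by
    have : 0 < b + 4 := by linarith
    rw [hC₂]; positivity
  refine ⟨C₁ + C₁ * C₂ + C₂, by positivity, ?_⟩
  intro r d n D E hn hED hLE X hXn hX Ω _ μ _ w Q hw hwind hQm hQ hind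
  have hn0 : (0 : ℝ) < n := by exact_mod_cast (by omega : 0 < n)
  have hn3 : (3 : ℝ) ≤ n := by exact_mod_cast hn
  obtain ⟨L, hL⟩ : ∃ L : ℝ, L = Real.log n := ⟨_, rfl⟩
  rw [← hL] at hLE ⊢
  have hL1 : 1 ≤ L := by
    rw [hL, Real.le_log_iff_exp_le hn0]
    linarith [Real.exp_one_lt_d9]
  have hL0 : 0 ≤ L := by linarith
  have hE0 : (0 : ℝ) < E := by linarith
  have hE : 0 < E := by exact_mod_cast hE0
  have hD : 0 < D := hE.trans_le hED
  have hexp : Real.exp (-(b * L)) = (n : ℝ) ^ (-b) := by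
    rw [Real.rpow_def_of_pos hn0, hL]
    congr 1
    ring
  obtain ⟨m, hm, hmb⟩ := hmom r L hL1
  obtain ⟨η, hη⟩ : ∃ η : ℝ, η = √L / √(E : ℝ) := ⟨_, rfl⟩
  obtain ⟨α, hα⟩ : ∃ α : ℝ, α = 2 ^ (r + 1) * L ^ (r + 1) / √(D : ℝ) := ⟨_, rfl⟩
  rw [← hη, ← hα]
  have hη0 : 0 ≤ η := by rw [hη]; positivity
  have hη1 : η ≤ 1 := by
    rw [hη]
    exact div_le_one_of_le₀ (Real.sqrt_le_sqrt hLE) (Real.sqrt_nonneg _)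
  have hα0 : 0 ≤ α := by rw [hα]; positivity
  have hαC : C₁ * (2 * L) ^ (r + 1) / √(D : ℝ) = C₁ * α := by rw [hα, mul_pow]; ring
  have hWm : AEMeasurable (fun ω i j => w i j ω) μ :=
    aemeasurable_pi_iff.2 fun i => aemeasurable_pi_iff.2 fun j => (hw i j).aemeasurable
  let Z : Ω → EuclideanSpace ℝ (Fin d) → EuclideanSpace ℝ (Fin D) :=
    fun ω x => randomFeatureMap (fun i j => w i j ω) x
  let A : Ω → EuclideanSpace ℝ (Fin D) →ₗ[ℝ] EuclideanSpace ℝ (Fin E) :=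
    fun ω => Matrix.toEuclideanLin (Matrix.of fun k i => Q k i ω)
  -- the exceptional events attached to a pair of points
  let B₀ : EuclideanSpace ℝ (Fin d) × EuclideanSpace ℝ (Fin d) → Set Ω := fun p =>
    {ω | C₁ * α ≤ |⟪p.1, p.2⟫ ^ r - ⟪Z ω p.1, Z ω p.2⟫|}
  let B₁ : EuclideanSpace ℝ (Fin d) × EuclideanSpace ℝ (Fin d) → Set Ω := fun p =>
    {ω | C₂ * η * ‖Z ω p.1 + Z ω p.2‖ ^ 2
      < |‖A ω (Z ω p.1 + Z ω p.2)‖ ^ 2 - ‖Z ω p.1 + Z ω p.2‖ ^ 2|}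
  let B₂ : EuclideanSpace ℝ (Fin d) × EuclideanSpace ℝ (Fin d) → Set Ω := fun p =>
    {ω | C₂ * η * ‖Z ω p.1 - Z ω p.2‖ ^ 2
      < |‖A ω (Z ω p.1 - Z ω p.2)‖ ^ 2 - ‖Z ω p.1 - Z ω p.2‖ ^ 2|}
  have hB₀ : ∀ p ∈ X ×ˢ X, μ.real (B₀ p) ≤ (n : ℝ) ^ (-b) := by
    intro p hp
    rw [Finset.mem_product] at hp
    have h := measureReal_randomFeatureMap_le hw hwind hD (hX _ hp.1) (hX _ hp.2) hm
      (t := C₁ * (2 * L) ^ (r + 1)) (by positivity)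
    rw [hαC] at h
    exact h.trans (hmb.trans hexp.le)
  have hB₁ : ∀ p, μ.real (B₁ p) ≤ 2 * (n : ℝ) ^ (-b) := by
    intro p
    have h := hQ.measureReal_norm_sq_le hQm hE hED hL0 hLE b hWm hind
      (f := fun v => randomFeatureMap v p.1 + randomFeatureMap v p.2)
      ((measurable_randomFeatureMap p.1).add (measurable_randomFeatureMap p.2))
    rw [← hC₂, ← hη, hexp] at h
    exact h
  have hB₂ : ∀ p, μ.real (B₂ p) ≤ 2 * (n : ℝ) ^ (-b) := by
    intro p
    have h := hQ.measureReal_norm_sq_le hQm hE hED hL0 hLE b hWm hind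
      (f := fun v => randomFeatureMap v p.1 - randomFeatureMap v p.2)
      ((measurable_randomFeatureMap p.1).sub (measurable_randomFeatureMap p.2))
    rw [← hC₂, ← hη, hexp] at h
    exact h
  have hbad : μ.real (⋃ p ∈ X ×ˢ X, (B₀ p ∪ (B₁ p ∪ B₂ p))) ≤ (n : ℝ) ^ (-a) := by
    have hcard : ((X ×ˢ X).card : ℝ) ≤ (n : ℝ) ^ 2 := by
      rw [Finset.card_product, Nat.cast_mul, pow_two]
      have : (X.card : ℝ) ≤ n := by exact_mod_cast hXn
      gcongr
    have hsplit : (n : ℝ) ^ (-b) = (n : ℝ) ^ (-a) * ((n : ℝ) ^ 4)⁻¹ := by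
      rw [hb, neg_add, Real.rpow_add hn0, Real.rpow_neg hn0.le 4]
      norm_cast
    calc μ.real (⋃ p ∈ X ×ˢ X, (B₀ p ∪ (B₁ p ∪ B₂ p)))
        ≤ ∑ p ∈ X ×ˢ X, μ.real (B₀ p ∪ (B₁ p ∪ B₂ p)) := measureReal_biUnion_finset_le _ _
      _ ≤ ∑ _p ∈ X ×ˢ X, 5 * (n : ℝ) ^ (-b) := by
          refine Finset.sum_le_sum fun p hp => ?_
          have h1 := measureReal_union_le (μ := μ) (B₀ p) (B₁ p ∪ B₂ p)
          have h2 := measureReal_union_le (μ := μ) (B₁ p) (B₂ p)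
          linarith [hB₀ p hp, hB₁ p, hB₂ p]
      _ = (X ×ˢ X).card * (5 * (n : ℝ) ^ (-b)) := by rw [Finset.sum_const, nsmul_eq_mul]
      _ ≤ (n : ℝ) ^ 2 * (5 * (n : ℝ) ^ (-b)) := by gcongr
      _ = (n : ℝ) ^ (-a) * (5 / (n : ℝ) ^ 2) := by rw [hsplit]; field_simp
      _ ≤ (n : ℝ) ^ (-a) * 1 := by
          gcongr
          rw [div_le_one (by positivity)]
          nlinarith
      _ = _ := mul_one _
  -- outside the exceptional events the inequality holds
  have hsub : (⋃ p ∈ X ×ˢ X, (B₀ p ∪ (B₁ p ∪ B₂ p)))ᶜ ⊆ {ω | ∀ x ∈ X, ∀ x' ∈ X,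
      |⟪x, x'⟫ ^ r - ⟪craftMap (fun i j => w i j ω) (Matrix.of fun k i => Q k i ω) x,
        craftMap (fun i j => w i j ω) (Matrix.of fun k i => Q k i ω) x'⟫|
          ≤ (C₁ + C₁ * C₂ + C₂) * (α + η)} := by
    intro ω hω x hx x' hx'
    have hgood : ∀ y ∈ X, ∀ y' ∈ X, ω ∉ B₀ (y, y') ∧ ω ∉ B₁ (y, y') ∧ ω ∉ B₂ (y, y') := by
      intro y hy y' hy'
      by_contra h
      refine hω (Set.mem_biUnion (x := (y, y')) (by simp [hy, hy']) ?_)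
      simp only [Set.mem_union]
      tauto
    have hnorm : ∀ y ∈ X, ‖Z ω y‖ ^ 2 ≤ 1 + C₁ * α := by
      intro y hy
      have h := (hgood y hy y hy).1
      simp only [B₀, Set.mem_ofPred_eq, not_le] at h
      rw [real_inner_self_eq_norm_sq, real_inner_self_eq_norm_sq, hX y hy, one_pow, one_pow,
        abs_lt] at h
      linarith
    obtain ⟨h0, h1, h2⟩ := hgood x hx x' hx'
    simp only [B₀, B₁, B₂, Set.mem_ofPred_eq, not_le, not_lt] at h0 h1 h2
    have h3 := abs_inner_sub_inner_map_le (A ω) h1 h2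
    have h4 : C₂ * η * ((‖Z ω x‖ ^ 2 + ‖Z ω x'‖ ^ 2) / 2) ≤ C₂ * η * (1 + C₁ * α) := by
      gcongr
      linarith [hnorm x hx, hnorm x' hx']
    have h5 : C₂ * C₁ * α * η ≤ C₂ * C₁ * α * 1 := by gcongr
    calc |⟪x, x'⟫ ^ r - ⟪A ω (Z ω x), A ω (Z ω x')⟫|
        ≤ |⟪x, x'⟫ ^ r - ⟪Z ω x, Z ω x'⟫|
          + |⟪Z ω x, Z ω x'⟫ - ⟪A ω (Z ω x), A ω (Z ω x')⟫| := abs_sub_le _ _ _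
      _ ≤ C₁ * α + C₂ * η * (1 + C₁ * α) := add_le_add h0.le (h3.trans h4)
      _ ≤ (C₁ + C₁ * C₂) * α + C₂ * η := by linarith
      _ ≤ (C₁ + C₁ * C₂ + C₂) * (α + η) := by
          have e1 : 0 ≤ C₂ * α := by positivity
          have e2 : 0 ≤ (C₁ + C₁ * C₂) * η := by positivity
          linarith
  have huniv : 1 ≤ μ.real (⋃ p ∈ X ×ˢ X, (B₀ p ∪ (B₁ p ∪ B₂ p)))
      + μ.real (⋃ p ∈ X ×ˢ X, (B₀ p ∪ (B₁ p ∪ B₂ p)))ᶜ := by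
    have h := measureReal_union_le (μ := μ) (⋃ p ∈ X ×ˢ X, (B₀ p ∪ (B₁ p ∪ B₂ p)))
      (⋃ p ∈ X ×ˢ X, (B₀ p ∪ (B₁ p ∪ B₂ p)))ᶜ
    rwa [Set.union_compl_self, probReal_univ] at h
  have hmono := measureReal_mono (μ := μ) hsub
  linarith
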